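/- Let $n\ge 1$, $s\in(0,1]$, $p\in(n/(n+s),\infty)$, $\ell\in\{0,1,2,\dots\}$ and $m\in(n+1,\infty)$. All functions and distributions on $\mathbb R^n$ are complex valued. **Hajłasz–Sobolev space.** For a measurable $f$ on $\mathbb R^n$ let $\mathcal D(f)$ be the set of nonnegative Borel functions $g$ for which there is a set $E$ of measure zero with $|f(x)-f(y)|\le |x-y|^s\,(g(x)+g(y))$ for all $x,y\in\mathbb R^n\setminus E$. Let $\dot M^{s,p}(\mathbb R^n)$ be the set of all $f\in L^p_{\mathrm{loc}}(\mathbb R^n)$ with $\mathcal D(f)\cap L^p(\mathbb R^n)\neq\emptyset$, and put $\|f\|_{\dot M^{s,p}}=\inf_{g\in\mathcal D(f)}\|g\|_{L^p}$. **Grand Triebel–Lizorkin space.** Let $\mathcal A=\mathcal A^\ell_{0,m}$ be the set of Schwartz functions $\phi$ on $\mathbb R^n$ with $\int_{\mathbb R^n}\phi(x)\,dx=0$ and $$\sup_{|\alpha|\le \ell+1}\ \sup_{x\in\mathbb R^n}(1+|x|)^m|\partial^\alpha\phi(x)|\le 1 .$$ With $\phi_t(x)=t^{-n}\phi(t^{-1}x)$,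 let $\mathcal A\dot F^s_{p,\infty}(\mathbb R^n)$ be the set of tempered distributions $T$ with $$\|T\|_{\mathcal A\dot F^s_{p,\infty}}=\Big\|\sup_{k\in\mathbb Z}2^{ks}\sup_{\phi\in\mathcal A}|\phi_{2^{-k}}*T|\Big\|_{L^p(\mathbb R^n)}<\infty .$$ A locally integrable function $f$ is said to represent the tempered distribution $T$ if, for every Schwartz function $\psi$, $f\psi$ is integrable and $T(\psi)=\int_{\mathbb R^n} f\psi\,dx$. **Theorem 1.1.** Under this identification, $\dot M^{s,p}(\mathbb R^n)=\mathcal A\dot F^s_{p,\infty}(\mathbb R^n)$ with equivalent norms. That is: 1. every $f\in\dot M^{s,p}(\mathbb R^n)$ represents a tempered distribution, and this distribution lies in $\mathcal A\dot F^s_{p,\infty}(\mathbb R^n)$; 2. every $T\in\mathcal A\dot F^s_{p,\infty}(\mathbb R^n)$ is represented by a function $f\in\dot M^{s,p}(\mathbb R^n)$, and every function that represents $T$ equals $f$ almost everywhere; 3. there is a constant $C>0$, depending only on $n,s,p,\ell,m$, such that $\|T\|_{\mathcal A\dot F^s_{p,\infty}}\le C\|f\|_{\dot M^{s,p}}$ and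 $\|f\|_{\dot M^{s,p}}\le C\|T\|_{\mathcal A\dot F^s_{p,\infty}}$ whenever $f\in\dot M^{s,p}(\mathbb R^n)$ represents $T$. -/

import Mathlib

open MeasureTheory
open scoped SchwartzMap LineDeriv ENNReal NNReal

noncomputable section

namespace GrandTL

/-- The Euclidean space `ℝⁿ` with its Euclidean norm and Lebesgue measure. -/
abbrev Rn (n : ℕ) : Type := EuclideanSpace ℝ (Fin n)

/-! ### Hajłasz–Sobolev spaces -/

/-- `g` belongs to `𝒟(f)`: it is a nonnegative Borel function, and outside of a null set `E`
one has `|f(x) - f(y)| ≤ |x - y|^s (g(x) + g(y))`. -/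
def IsHajlaszGradient {n : ℕ} (s : ℝ) (f : Rn n → ℂ) (g : Rn n → ℝ) : Prop :=
  Measurable g ∧ (∀ x, 0 ≤ g x) ∧
    ∃ E : Set (Rn n), volume E = 0 ∧
      ∀ x, x ∉ E → ∀ y, y ∉ E → ‖f x - f y‖ ≤ dist x y ^ s * (g x + g y)

/-- The (Lebesgue) measurable function `f` lies in `L^p_loc(ℝⁿ)`. -/
def MemLpLoc {n : ℕ} (p : ℝ) (f : Rn n → ℂ) : Prop :=
  AEStronglyMeasurable f volume ∧
    ∀ K : Set (Rn n), IsCompact K → MemLp f (ENNReal.ofReal p) (volume.restrict K)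

/-- The homogeneous fractional Hajłasz–Sobolev space `Ṁ^{s,p}(ℝⁿ)`. -/
def MemHajlasz {n : ℕ} (s p : ℝ) (f : Rn n → ℂ) : Prop :=
  MemLpLoc p f ∧
    ∃ g : Rn n → ℝ, IsHajlaszGradient s f g ∧ MemLp g (ENNReal.ofReal p) volume

/-- `‖f‖_{Ṁ^{s,p}(ℝⁿ)} = inf { ‖g‖_{L^p} : g ∈ 𝒟(f) }`, as an extended nonnegative number. -/
def hajlaszNorm {n : ℕ} (s p : ℝ) (f : Rn n → ℂ) : ℝ≥0∞ :=
  ⨅ (g : Rn n → ℝ) (_ : IsHajlaszGradient s f g), eLpNorm g (ENNReal.ofReal p) volume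

/-! ### The test functions -/

/-- `∂^α φ = (∂/∂x₁)^{α₁} ⋯ (∂/∂xₙ)^{αₙ} φ` for a multi-index `α` and a Schwartz function `φ`. -/
def partialDeriv {n : ℕ} (α : Fin n → ℕ) (φ : 𝓢(Rn n, ℂ)) : 𝓢(Rn n, ℂ) :=
  (List.finRange n).foldr
    (fun i ψ => (fun χ : 𝓢(Rn n, ℂ) => ∂_{EuclideanSpace.single i (1 : ℝ)} χ)^[α i] ψ) φ

/-- `‖φ‖_{𝒮_{k,m}} = sup_{|α| ≤ k} sup_x (1 + |x|)^m |∂^α φ(x)|`, for real `m`. -/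
def schwartzNorm {n : ℕ} (k : ℕ) (m : ℝ) (φ : 𝓢(Rn n, ℂ)) : ℝ≥0∞ :=
  ⨆ (α : Fin n → ℕ) (_ : ∑ i, α i ≤ k) (x : Rn n),
    ENNReal.ofReal ((1 + ‖x‖) ^ m) * ‖partialDeriv α φ x‖ₑ

/-- The class `𝒜^ℓ_{N,m}`: the Schwartz functions `φ` whose moments of order at most `N` vanish
and which satisfy `‖φ‖_{𝒮_{N+ℓ+1,m}} ≤ 1`. -/
def testClass (n N ℓ : ℕ) (m : ℝ) : Set 𝓢(Rn n, ℂ) :=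
  {φ | (∀ α : Fin n → ℕ, ∑ i, α i ≤ N → ∫ x : Rn n, (∏ i, (x i : ℂ) ^ α i) * φ x = 0) ∧
    schwartzNorm (N + ℓ + 1) m φ ≤ 1}

/-! ### Convolution with dilated test functions -/

/-- The dilation `φ_t(x) = t^{-n} φ(t^{-1} x)`, `t > 0`. -/
def dilate {n : ℕ} (t : ℝ) (ht : 0 < t) (φ : 𝓢(Rn n, ℂ)) : 𝓢(Rn n, ℂ) :=
  (t ^ n)⁻¹ • SchwartzMap.compCLMOfContinuousLinearEquiv ℂ
    (ContinuousLinearEquiv.smulLeft (M₁ := Rn n) (R₁ := ℝ) (Units.mk0 t⁻¹ (inv_ne_zero ht.ne'))) φ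

theorem dilate_apply {n : ℕ} (t : ℝ) (ht : 0 < t) (φ : 𝓢(Rn n, ℂ)) (x : Rn n) :
    dilate t ht φ x = ((t ^ n)⁻¹ : ℝ) • φ (t⁻¹ • x) := rfl

/-- The Schwartz function `y ↦ φ(x - y)`. -/
def reflectTranslate {n : ℕ} (x : Rn n) (φ : 𝓢(Rn n, ℂ)) : 𝓢(Rn n, ℂ) :=
  SchwartzMap.compSubConstCLM ℂ x
    (SchwartzMap.compCLMOfContinuousLinearEquiv ℂ (ContinuousLinearEquiv.neg ℝ (M := Rn n)) φ)

theorem reflectTranslate_apply {n : ℕ} (x : Rn n) (φ : 𝓢(Rn n, ℂ)) (y : Rn n) :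
    reflectTranslate x φ y = φ (x - y) := by
  simp [reflectTranslate]

/-- The convolution `(φ * f)(x) = ⟨f, φ(x - ·)⟩` of a Schwartz function and a tempered
distribution. -/
def conv {n : ℕ} (φ : 𝓢(Rn n, ℂ)) (f : 𝓢'(Rn n, ℂ)) (x : Rn n) : ℂ :=
  f (reflectTranslate x φ)

/-! ### Grand Triebel–Lizorkin spaces with `q = ∞` -/

/-- `x ↦ sup_{k ∈ ℤ} 2^{ks} sup_{φ ∈ 𝒜} |(φ_{2^{-k}} * f)(x)|`. -/
def grandMaximal {n : ℕ} (A : Set 𝓢(Rn n, ℂ)) (s : ℝ) (f : 𝓢'(Rn n, ℂ)) (x : Rn n) : ℝ≥0∞ :=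
  ⨆ k : ℤ, ENNReal.ofReal ((2 : ℝ) ^ ((k : ℝ) * s)) *
    ⨆ φ ∈ A, ‖conv (dilate ((2 : ℝ) ^ (-k)) (by positivity) φ) f x‖ₑ

/-- `‖f‖_{𝒜Ḟ^s_{p,∞}(ℝⁿ)}`, the `L^p` (quasi-)norm of the function above. -/
def grandTLNorm {n : ℕ} (A : Set 𝓢(Rn n, ℂ)) (s p : ℝ) (f : 𝓢'(Rn n, ℂ)) : ℝ≥0∞ :=
  eLpNorm (grandMaximal A s f) (ENNReal.ofReal p) volume

/-- The tempered distribution `f` lies in `𝒜Ḟ^s_{p,∞}(ℝⁿ)`. -/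
def MemGrandTL {n : ℕ} (A : Set 𝓢(Rn n, ℂ)) (s p : ℝ) (f : 𝓢'(Rn n, ℂ)) : Prop :=
  grandTLNorm A s p f < ∞

/-! ### Functions as tempered distributions -/

/-- The tempered distribution `T` is given by integration against the locally integrable
function `f`. -/
def Represents {n : ℕ} (f : Rn n → ℂ) (T : 𝓢'(Rn n, ℂ)) : Prop :=
  LocallyIntegrable f volume ∧
    ∀ ψ : 𝓢(Rn n, ℂ), Integrable (fun x => f x * ψ x) volume ∧ T ψ = ∫ x, f x * ψ x

end GrandTL

end

/-! Both inclusions compare a function with its values at a single scale `2 ^ (-k)`.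

From a Hajłasz gradient `G` to the grand maximal function: choose `r ≤ 1` with `n / (n + s) < r <
p`. For `p < 1` the gradient need not be locally integrable, but `G ^ r` is. Chaining through points
of shrinking balls at which `G` is at most its mean of order `r` gives a Poincaré inequality: the
integral over the ball of radius `2 ^ j` about `x` of the oscillation of `f` is at most a constant
times `2 ^ (j * (n + s))` times `maximalPow r G x` (`exists_setLIntegral_enorm_sub_le`). The chain
loses `2 ^ (i * n * (1 / r - 1))` at its `i`-th ball and gains `2 ^ (-i * s)`; the sum converges
because `n * (1 / r - 1) < s`, which is `n / (n + s) < r`. Summing over dyadic balls against the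
decay of a test function, whose mean vanishes so that a constant may be subtracted from `f`, bounds
the grand maximal function pointwise by `maximalPow r G` (`exists_grandMaximal_le`). The
Hardy–Littlewood theorem on `L ^ (p / r)` finishes this direction. The same weighted estimate shows
that `f` is integrable against Schwartz functions.

Conversely, let `G` be the grand maximal function of `T` and `u k` the mollification of `T` at scale
`2 ^ (-k)`, by a Schwartz function with integral one. Both `u (k + 1) - u k` and the difference of
`u k` at two points within `2 ^ (-k)` are convolutions of `T` with dilates of functions of mean
zero, hence at most a constant times `2 ^ (-k * s) * G`. So `u k` converges to some `f` wherever `G`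
is finite, and comparison at the scale of `dist x y` makes a multiple of `G` a gradient of `f`
(`isGradientOff_of_approx`).

It remains to see that `f` represents `T`. The bound of `f - u k` by `2 ^ (-k * s) * G` does not
give convergence in `L¹` locally, since `G` is only in `L ^ p`. Instead, `f - u k` has the gradient
`2 ^ (-k * (s - s')) * G`, up to a constant, of any smaller order `s'`
(`isGradientOff_sub_of_approx`). If `s'` is so close to `s` that `n / (n + s') < p`, the Poincaré
inequality of order `s'` gives convergence in a weighted `L¹` space, while `u k` tends to `T` as a
distribution. -/

namespace GrandTL

open Metric Set

/-! ### The dyadic-radius Hardy–Littlewood maximal function -/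

/-- The supremum of the averages of `h` over the closed balls around `x` whose radius is a power
of two. -/
noncomputable def dyadicMaximal {n : ℕ} (h : Rn n → ℝ≥0∞) (x : Rn n) : ℝ≥0∞ :=
  ⨆ j : ℤ, ⨍⁻ y in closedBall x ((2 : ℝ) ^ j), h y ∂volume

theorem volume_closedBall_eq {n : ℕ} (x : Rn n) {r : ℝ} (hr : 0 ≤ r) :
    volume (closedBall x r) = ENNReal.ofReal (r ^ n) * volume (ball (0 : Rn n) 1) := by
  simpa using Measure.addHaar_closedBall (volume : Measure (Rn n)) x hr

theorem volume_closedBall_ne_zero {n : ℕ} (x : Rn n) {r : ℝ} (hr : 0 < r) :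
    volume (closedBall x r) ≠ 0 :=
  (measure_closedBall_pos volume x hr).ne'

theorem volume_closedBall_ne_top {n : ℕ} (x : Rn n) (r : ℝ) :
    volume (closedBall x r) ≠ ∞ :=
  measure_closedBall_lt_top.ne

theorem volume_closedBall_mul {n : ℕ} (x y : Rn n) {c r : ℝ} (hc : 0 ≤ c) (hr : 0 ≤ r) :
    volume (closedBall x (c * r)) = ENNReal.ofReal (c ^ n) * volume (closedBall y r) := by
  rw [volume_closedBall_eq x (mul_nonneg hc hr), volume_closedBall_eq y hr, mul_pow,
    ENNReal.ofReal_mul (by positivity), mul_assoc]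

theorem measurable_setLIntegral_closedBall {n : ℕ} {h : Rn n → ℝ≥0∞} (hh : Measurable h) (r : ℝ) :
    Measurable fun x : Rn n => ∫⁻ y in closedBall x r, h y := by
  have : (fun x : Rn n => ∫⁻ y in closedBall x r, h y) =
      fun x => ∫⁻ y, {q : Rn n × Rn n | dist q.2 q.1 ≤ r}.indicator (fun q => h q.2) (x, y) := by
    ext x
    rw [← lintegral_indicator measurableSet_closedBall]
    rfl
  rw [this]
  refine Measurable.lintegral_prod_right' (Measurable.indicator (hh.comp measurable_snd) ?_)
  exact measurableSet_le (measurable_snd.dist measurable_fst) measurable_const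

theorem measurable_dyadicMaximal {n : ℕ} {h : Rn n → ℝ≥0∞} (hh : Measurable h) :
    Measurable (dyadicMaximal h) := by
  refine Measurable.iSup fun j => ?_
  have : (fun x : Rn n => ⨍⁻ y in closedBall x ((2 : ℝ) ^ j), h y ∂volume) =
      fun x => (∫⁻ y in closedBall x ((2 : ℝ) ^ j), h y ∂volume) /
        volume (closedBall (0 : Rn n) ((2 : ℝ) ^ j)) := by
    ext x
    rw [setLAverage_eq, volume_closedBall_eq x (by positivity),
      volume_closedBall_eq 0 (by positivity)]
  rw [this]
  exact (measurable_setLIntegral_closedBall hh _).div_const _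

theorem setLIntegral_closedBall_le_dyadicMaximal {n : ℕ} (h : Rn n → ℝ≥0∞) (x : Rn n) (j : ℤ) :
    ∫⁻ y in closedBall x ((2 : ℝ) ^ j), h y ≤
      volume (closedBall x ((2 : ℝ) ^ j)) * dyadicMaximal h x := by
  rw [← measure_mul_setLAverage _ (volume_closedBall_ne_top x _)]
  gcongr
  exact le_iSup (fun j : ℤ => ⨍⁻ y in closedBall x ((2 : ℝ) ^ j), h y ∂volume) j

/-- The weak type `(1,1)` estimate for averages over balls of bounded radius. -/
theorem mul_volume_setOf_lt_setLAverage_le {n : ℕ} (h : Rn n → ℝ≥0∞) (c : ℝ≥0∞) (J : ℤ) :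
    c * volume {x : Rn n | ∃ j ≤ J, c < ⨍⁻ y in closedBall x ((2 : ℝ) ^ j), h y ∂volume} ≤
      5 ^ n * ∫⁻ y, h y := by
  set S := {x : Rn n | ∃ j ≤ J, c < ⨍⁻ y in closedBall x ((2 : ℝ) ^ j), h y ∂volume}
  choose! j hjJ hj using fun (x : Rn n) (hx : x ∈ S) => hx
  -- Vitali's covering lemma needs bounded radii, which is the role of `J`; any enlargement factor
  -- above 3 would do.
  obtain ⟨u, huS, hdisj, hcov⟩ := Vitali.exists_disjoint_subfamily_covering_enlargement_closedBall
    S id (fun x => (2 : ℝ) ^ j x) ((2 : ℝ) ^ J)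
    (fun x hx => zpow_le_zpow_right₀ (by norm_num) (hjJ x hx)) 5 (by norm_num)
  simp only [id] at hdisj hcov
  have hcount : u.Countable := hdisj.countable_of_nonempty_interior fun x _ =>
    ⟨x, mem_interior_iff_mem_nhds.2 (closedBall_mem_nhds x (by positivity))⟩
  have hsub : S ⊆ ⋃ b ∈ u, closedBall b (5 * (2 : ℝ) ^ j b) := fun x hx => by
    obtain ⟨b, hb, hxb⟩ := hcov x hx
    exact mem_biUnion hb (hxb (mem_closedBall_self (by positivity)))
  have : Countable u := hcount.to_subtype
  calc c * volume S ≤ c * ∑' b : u, volume (closedBall (b : Rn n) (5 * (2 : ℝ) ^ j b)) := by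
        gcongr
        exact (measure_mono hsub).trans (measure_biUnion_le _ hcount _)
    _ = 5 ^ n * ∑' b : u, c * volume (closedBall (b : Rn n) ((2 : ℝ) ^ j b)) := by
        rw [← ENNReal.tsum_mul_left, ← ENNReal.tsum_mul_left]
        refine tsum_congr fun b => ?_
        rw [volume_closedBall_mul (b : Rn n) (b : Rn n) (by norm_num) (by positivity),
          ENNReal.ofReal_pow (by norm_num)]
        simp only [ENNReal.ofReal_ofNat]
        ring
    _ ≤ 5 ^ n * ∑' b : u, ∫⁻ y in closedBall (b : Rn n) ((2 : ℝ) ^ j b), h y := by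
        gcongr with b
        have := (hj b (huS b.2)).le
        rwa [setLAverage_eq, ENNReal.le_div_iff_mul_le
          (Or.inl (volume_closedBall_ne_zero _ (by positivity)))
          (Or.inl (volume_closedBall_ne_top _ _))] at this
    _ = 5 ^ n * ∫⁻ y in ⋃ b : u, closedBall (b : Rn n) ((2 : ℝ) ^ j b), h y := by
        rw [lintegral_iUnion (fun b => measurableSet_closedBall)]
        intro a b hab
        exact hdisj a.2 b.2 (Subtype.coe_ne_coe.2 hab)
    _ ≤ 5 ^ n * ∫⁻ y, h y := by
        exact mul_le_mul_right (setLIntegral_le_lintegral _ _) _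

/-- The weak type `(1,1)` estimate for the maximal function. -/
theorem mul_volume_setOf_lt_dyadicMaximal_le {n : ℕ} (h : Rn n → ℝ≥0∞) (c : ℝ≥0∞) :
    c * volume {x : Rn n | c < dyadicMaximal h x} ≤ 5 ^ n * ∫⁻ y, h y := by
  have hS : {x : Rn n | c < dyadicMaximal h x} =
      ⋃ J : ℤ, {x | ∃ j ≤ J, c < ⨍⁻ y in closedBall x ((2 : ℝ) ^ j), h y ∂volume} := by
    ext x
    simp only [dyadicMaximal, lt_iSup_iff, mem_ofPred_eq, mem_iUnion]
    exact ⟨fun ⟨j, hj⟩ => ⟨j, j, le_rfl, hj⟩, fun ⟨_, j, _, hj⟩ => ⟨j, hj⟩⟩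
  -- The level sets increase with `J` and the bound does not depend on `J`, so the restriction on
  -- the radii disappears in the limit.
  rw [hS, Monotone.measure_iUnion, ENNReal.mul_iSup]
  · exact iSup_le fun J => mul_volume_setOf_lt_setLAverage_le h c J
  · rintro J J' hJ x ⟨j, hj, hx⟩
    exact ⟨j, hj.trans hJ, hx⟩

/-- The weak type estimate in which only the large values of the function enter. -/
theorem mul_volume_setOf_lt_dyadicMaximal_le_setLIntegral {n : ℕ} {h : Rn n → ℝ≥0∞}
    (hh : Measurable h) (c : ℝ≥0∞) :
    c * volume {x : Rn n | c < dyadicMaximal h x} ≤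
      2 * 5 ^ n * ∫⁻ y in {y | c < 2 * h y}, h y := by
  have hc2 : c / 2 + c / 2 = c := ENNReal.add_halves c
  have hms : MeasurableSet {y | c < 2 * h y} := measurableSet_lt measurable_const (hh.const_mul 2)
  set h' := {y | c < 2 * h y}.indicator h
  have hle : ∀ y, h y ≤ h' y + c / 2 := fun y => by
    by_cases hy : c < 2 * h y
    · simp [h', hy]
    · have : h y ≤ c / 2 := by
        rw [ENNReal.le_div_iff_mul_le (by simp) (by simp), mul_comm]
        exact not_lt.1 hy
      exact this.trans le_add_self
  -- Since `h ≤ h' + c / 2`, an average of `h` above `c` forces the same average of `h'` to be above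
  -- `c / 2`.
  have hsub : {x : Rn n | c < dyadicMaximal h x} ⊆ {x | c / 2 < dyadicMaximal h' x} := by
    intro x hx
    obtain ⟨j, hj⟩ := lt_iSup_iff.1 (show c < dyadicMaximal h x from hx)
    show c / 2 < ⨆ j : ℤ, ⨍⁻ y in closedBall x ((2 : ℝ) ^ j), h' y ∂volume
    refine lt_iSup_iff.2 ⟨j, ?_⟩
    by_contra hcon
    refine hj.not_ge ?_
    rw [setLAverage_eq] at hcon ⊢
    have hv0 := volume_closedBall_ne_zero x (show (0 : ℝ) < 2 ^ j by positivity)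
    have hvt := volume_closedBall_ne_top x ((2 : ℝ) ^ j)
    calc _ ≤ (∫⁻ y in closedBall x ((2 : ℝ) ^ j), (h' y + c / 2)) /
          volume (closedBall x ((2 : ℝ) ^ j)) := by
          gcongr with y
          exact hle y
      _ = (∫⁻ y in closedBall x ((2 : ℝ) ^ j), h' y) / volume (closedBall x ((2 : ℝ) ^ j))
            + c / 2 := by
          rw [lintegral_add_right _ measurable_const, ENNReal.add_div, setLIntegral_const,
            ENNReal.mul_div_cancel_right hv0 hvt]
      _ ≤ c / 2 + c / 2 := add_le_add_left (not_lt.1 hcon) _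
      _ = c := hc2
  calc c * volume {x : Rn n | c < dyadicMaximal h x}
      ≤ 2 * (c / 2 * volume {x : Rn n | c / 2 < dyadicMaximal h' x}) := by
        rw [← mul_assoc, ENNReal.mul_div_cancel (by simp) (by simp)]
        gcongr
    _ ≤ 2 * (5 ^ n * ∫⁻ y, h' y) := by
        exact mul_le_mul_right (mul_volume_setOf_lt_dyadicMaximal_le h' _) _
    _ = _ := by rw [lintegral_indicator hms, mul_assoc]

theorem lintegral_Ioo_rpow {a : ℝ} (ha : 0 < a) {b : ℝ} (hb : 0 ≤ b) :
    ∫⁻ t in Ioo 0 b, ENNReal.ofReal (a * t ^ (a - 1)) = ENNReal.ofReal (b ^ a) := by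
  have hint : IntervalIntegrable (fun t : ℝ => a * t ^ (a - 1)) volume 0 b :=
    (intervalIntegral.intervalIntegrable_rpow' (by linarith)).const_mul a
  rw [setLIntegral_congr Ioo_ae_eq_Ioc, ← ofReal_integral_eq_lintegral_ofReal]
  · rw [← intervalIntegral.integral_of_le hb, intervalIntegral.integral_const_mul,
      integral_rpow (Or.inl (by linarith))]
    congr 1
    simp only [sub_add_cancel, Real.zero_rpow ha.ne', sub_zero]
    field_simp
  · rwa [intervalIntegrable_iff_integrableOn_Ioc_of_le hb] at hint
  · filter_upwards [ae_restrict_mem measurableSet_Ioc] with t ht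
    have := ht.1
    positivity

/-- The layer cake formula for a power of an extended nonnegative number. -/
theorem lintegral_Ioi_indicator_rpow {a : ℝ} (ha : 0 < a) (y : ℝ≥0∞) :
    ∫⁻ t in Ioi (0 : ℝ), {t : ℝ | ENNReal.ofReal t < y}.indicator
      (fun t => ENNReal.ofReal (a * t ^ (a - 1))) t = y ^ a := by
  have hms : MeasurableSet {t : ℝ | ENNReal.ofReal t < y} :=
    measurableSet_lt ENNReal.measurable_ofReal measurable_const
  rw [setLIntegral_indicator hms]
  induction y with
  | top =>
    rw [ENNReal.top_rpow_of_pos ha]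
    refine ENNReal.eq_top_of_forall_nnreal_le fun r => ?_
    calc (r : ℝ≥0∞) = ENNReal.ofReal (((r : ℝ) ^ a⁻¹) ^ a) := by
          rw [Real.rpow_inv_rpow r.coe_nonneg ha.ne', ENNReal.ofReal_coe_nnreal]
      _ = _ := (lintegral_Ioo_rpow ha (by positivity)).symm
      _ ≤ _ := by
          refine lintegral_mono_set fun t ht => ?_
          exact ⟨by simp, ht.1⟩
  | coe r =>
    have : {t : ℝ | ENNReal.ofReal t < r} ∩ Ioi 0 = Ioo (0 : ℝ) r := by
      ext t
      simp only [mem_inter_iff, mem_ofPred_eq, mem_Ioi, mem_Ioo, and_comm]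
      refine and_congr_left fun ht => ?_
      rw [← ENNReal.ofReal_coe_nnreal, ENNReal.ofReal_lt_ofReal_iff_of_nonneg ht.le]
    rw [this, lintegral_Ioo_rpow ha r.coe_nonneg,
      ← ENNReal.ofReal_rpow_of_nonneg r.coe_nonneg ha.le,
      ENNReal.ofReal_coe_nnreal]

/-- The Hardy–Littlewood maximal theorem on `L^P`, `P > 1`. -/
theorem exists_lintegral_dyadicMaximal_rpow_le (n : ℕ) {P : ℝ} (hP : 1 < P) :
    ∃ C : ℝ≥0, ∀ h : Rn n → ℝ≥0∞, Measurable h →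
      ∫⁻ x, dyadicMaximal h x ^ P ≤ C * ∫⁻ x, h x ^ P := by
  refine ⟨2 * 5 ^ n * Real.toNNReal (P / (P - 1)) * 2 ^ (P - 1), fun h hh => ?_⟩
  have hP0 : 0 < P - 1 := by linarith
  have hMm := measurable_dyadicMaximal hh
  -- Tonelli for the layer cake formula with a weight. It is used with weight 1 for the maximal
  -- function, and backwards with weight `h` for `2 * h`.
  have swap : ∀ (a : ℝ) (F w : Rn n → ℝ≥0∞), Measurable F → Measurable w →
      ∫⁻ x, w x * ∫⁻ t in Ioi (0 : ℝ), {t : ℝ | ENNReal.ofReal t < F x}.indicator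
        (fun t => ENNReal.ofReal (a * t ^ (a - 1))) t =
      ∫⁻ t in Ioi (0 : ℝ), ENNReal.ofReal (a * t ^ (a - 1)) *
        ∫⁻ x in {x | ENNReal.ofReal t < F x}, w x := by
    intro a F w hF hw
    have hm1 : ∀ x, Measurable ({t : ℝ | ENNReal.ofReal t < F x}.indicator
        (fun t => ENNReal.ofReal (a * t ^ (a - 1)))) := fun x =>
      Measurable.indicator (by fun_prop)
        (measurableSet_lt ENNReal.measurable_ofReal measurable_const)
    simp_rw [← lintegral_const_mul _ (hm1 _)]
    rw [lintegral_lintegral_swap]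
    · refine lintegral_congr fun t => ?_
      have hmt : MeasurableSet {x | ENNReal.ofReal t < F x} := measurableSet_lt measurable_const hF
      rw [← lintegral_const_mul _ hw, ← lintegral_indicator hmt]
      refine lintegral_congr fun x => ?_
      by_cases hx : ENNReal.ofReal t < F x <;> simp [hx, mul_comm]
    · refine Measurable.aemeasurable ?_
      have : (Function.uncurry fun (x : Rn n) (t : ℝ) => w x *
          {t : ℝ | ENNReal.ofReal t < F x}.indicator
            (fun t => ENNReal.ofReal (a * t ^ (a - 1))) t) =
          {q : Rn n × ℝ | ENNReal.ofReal q.2 < F q.1}.indicator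
            (fun q => w q.1 * ENNReal.ofReal (a * q.2 ^ (a - 1))) := by
        ext q
        by_cases hq : ENNReal.ofReal q.2 < F q.1 <;> simp [Function.uncurry, hq]
      rw [this]
      refine Measurable.indicator ?_
        (measurableSet_lt (ENNReal.measurable_ofReal.comp measurable_snd) (hF.comp measurable_fst))
      exact (hw.comp measurable_fst).mul (by fun_prop)
  calc ∫⁻ x, dyadicMaximal h x ^ P
      = ∫⁻ x, 1 * ∫⁻ t in Ioi (0 : ℝ), {t : ℝ | ENNReal.ofReal t < dyadicMaximal h x}.indicator
        (fun t => ENNReal.ofReal (P * t ^ (P - 1))) t := by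
        simp_rw [lintegral_Ioi_indicator_rpow (by linarith : 0 < P), one_mul]
    _ = ∫⁻ t in Ioi (0 : ℝ), ENNReal.ofReal (P * t ^ (P - 1)) *
        volume {x | ENNReal.ofReal t < dyadicMaximal h x} := by
        rw [swap P _ _ hMm measurable_const]
        simp
    _ ≤ ∫⁻ t in Ioi (0 : ℝ), 2 * 5 ^ n * ENNReal.ofReal (P / (P - 1)) *
          (ENNReal.ofReal ((P - 1) * t ^ (P - 1 - 1)) *
            ∫⁻ y in {y | ENNReal.ofReal t < 2 * h y}, h y) := by
        refine setLIntegral_mono' measurableSet_Ioi fun t ht => ?_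
        rw [mem_Ioi] at ht
        -- The spare factor `t` is consumed by the weak type estimate at height `t`; what is left is
        -- the layer cake density for the exponent `P - 1`.
        have e : P * t ^ (P - 1) = (P / (P - 1)) * ((P - 1) * t ^ (P - 1 - 1)) * t := by
          have : t ^ (P - 1) = t ^ (P - 1 - 1) * t := by
            rw [← Real.rpow_add_one ht.ne', sub_add_cancel]
          rw [this]
          field_simp
        rw [e, ENNReal.ofReal_mul (by positivity), ENNReal.ofReal_mul (by positivity)]
        calc _ = ENNReal.ofReal (P / (P - 1)) * ENNReal.ofReal ((P - 1) * t ^ (P - 1 - 1)) *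
              (ENNReal.ofReal t * volume {x | ENNReal.ofReal t < dyadicMaximal h x}) := by ring
          _ ≤ ENNReal.ofReal (P / (P - 1)) * ENNReal.ofReal ((P - 1) * t ^ (P - 1 - 1)) *
              (2 * 5 ^ n * ∫⁻ y in {y | ENNReal.ofReal t < 2 * h y}, h y) := by
              exact mul_le_mul_right
                (mul_volume_setOf_lt_dyadicMaximal_le_setLIntegral hh _) _
          _ = _ := by ring
    _ = 2 * 5 ^ n * ENNReal.ofReal (P / (P - 1)) * ∫⁻ x, h x * (2 * h x) ^ (P - 1) := by
        rw [lintegral_const_mul' _ _ (by finiteness),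
          ← swap (P - 1) (fun y => 2 * h y) h (hh.const_mul 2) hh]
        simp_rw [lintegral_Ioi_indicator_rpow hP0]
    _ = _ := by
        have : ∀ x, h x * (2 * h x) ^ (P - 1) = 2 ^ (P - 1) * h x ^ P := fun x => by
          rw [ENNReal.mul_rpow_of_nonneg _ _ hP0.le]
          have : h x ^ P = h x ^ (P - 1) * h x := by
            conv_rhs => rw [← ENNReal.rpow_one (h x), ← ENNReal.rpow_mul, one_mul]
            rw [← ENNReal.rpow_add_of_nonneg _ _ hP0.le zero_le_one, sub_add_cancel]
          rw [this]
          ring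
        simp_rw [this]
        rw [lintegral_const_mul' _ _ (by finiteness), ← mul_assoc]
        congr 1
        push_cast
        rw [ENNReal.coe_rpow_of_nonneg _ hP0.le]
        rfl

/-! ### A Poincaré inequality for functions with a Hajłasz gradient -/

/-- `G` is a Hajłasz gradient of `f` of order `s` outside of the null set `E`, and it is finite
there. -/
structure IsGradientOff {n : ℕ} (s : ℝ) (f : Rn n → ℂ) (G : Rn n → ℝ≥0∞) (E : Set (Rn n)) :
    Prop where
  measurable : Measurable G
  null : volume E = 0
  ne_top : ∀ x ∉ E, G x ≠ ∞
  le : ∀ x ∉ E, ∀ y ∉ E, ‖f x - f y‖ₑ ≤ ENNReal.ofReal (dist x y ^ s) * (G x + G y)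

/-- The maximal function `(M (G ^ r)) ^ (1 / r)`. -/
noncomputable def maximalPow {n : ℕ} (r : ℝ) (G : Rn n → ℝ≥0∞) (x : Rn n) : ℝ≥0∞ :=
  dyadicMaximal (fun y => G y ^ r) x ^ (1 / r)

theorem ofReal_two_zpow_rpow (j : ℤ) (s : ℝ) :
    ENNReal.ofReal (((2 : ℝ) ^ j) ^ s) = (2 : ℝ≥0∞) ^ ((j : ℝ) * s) := by
  rw [← Real.rpow_intCast, ← Real.rpow_mul (by norm_num),
    ← ENNReal.ofReal_rpow_of_pos (by norm_num)]
  simp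

theorem two_rpow_ne_top (a : ℝ) : (2 : ℝ≥0∞) ^ a ≠ ∞ := by finiteness

theorem two_rpow_add (a b : ℝ) : (2 : ℝ≥0∞) ^ (a + b) = 2 ^ a * 2 ^ b :=
  ENNReal.rpow_add _ _ (by norm_num) (by norm_num)

theorem volume_closedBall_two_zpow {n : ℕ} (x : Rn n) (j : ℤ) :
    volume (closedBall x ((2 : ℝ) ^ j)) =
      (2 : ℝ≥0∞) ^ ((j : ℝ) * n) * volume (ball (0 : Rn n) 1) := by
  rw [volume_closedBall_eq x (by positivity), ← ofReal_two_zpow_rpow, Real.rpow_natCast]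

theorem IsGradientOff.enorm_sub_le {n : ℕ} {s : ℝ} (hs : 0 < s) (hs1 : s ≤ 1)
    {f : Rn n → ℂ} {G : Rn n → ℝ≥0∞} {E : Set (Rn n)} (hG : IsGradientOff s f G E)
    {x y : Rn n} (hx : x ∉ E) (hy : y ∉ E) {c : ℝ} (hc : 1 ≤ c) {j : ℤ}
    (hd : dist x y ≤ c * 2 ^ j) :
    ‖f x - f y‖ₑ ≤ ENNReal.ofReal c * 2 ^ ((j : ℝ) * s) * (G x + G y) := by
  refine (hG.le x hx y hy).trans ?_
  gcongr
  rw [← ofReal_two_zpow_rpow, ← ENNReal.ofReal_mul (by positivity)]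
  refine ENNReal.ofReal_le_ofReal ?_
  calc dist x y ^ s ≤ (c * 2 ^ j) ^ s := by gcongr
    _ = c ^ s * (2 ^ j) ^ s := Real.mul_rpow (by positivity) (by positivity)
    _ ≤ c * (2 ^ j) ^ s := by
      gcongr
      calc c ^ s ≤ c ^ (1 : ℝ) := Real.rpow_le_rpow_of_exponent_le hc hs1
        _ = c := Real.rpow_one c

/-- In each ball there are points off the exceptional set at which the gradient is at most its
mean of order `r`. -/
theorem IsGradientOff.exists_le_average {n : ℕ} {s r : ℝ} (hr : 0 < r)
    {f : Rn n → ℂ} {G : Rn n → ℝ≥0∞} {E : Set (Rn n)} (hG : IsGradientOff s f G E)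
    (x : Rn n) {ρ : ℝ} (hρ : 0 < ρ) :
    ∃ w ∉ E, dist w x ≤ ρ ∧
      G w ≤ (⨍⁻ u in closedBall x ρ, G u ^ r ∂volume) ^ (1 / r) := by
  have h0 : volume.restrict (closedBall x ρ) ≠ 0 := by
    rw [Ne, Measure.restrict_eq_zero]
    exact volume_closedBall_ne_zero x hρ
  have : IsFiniteMeasure (volume.restrict (closedBall x ρ)) :=
    ⟨by simpa using measure_closedBall_lt_top⟩
  -- The complement of the ball is null for the restricted measure, so adjoining it to the
  -- exceptional set forces `w` into the ball.
  obtain ⟨w, hw, hle⟩ := exists_notMem_null_le_laverage h0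
    (hG.measurable.pow_const r).aemeasurable
    (N := E ∪ (closedBall x ρ)ᶜ) (by
      rw [measure_union_null_iff]
      exact ⟨Measure.restrict_le_self.absolutelyContinuous hG.null, by
        rw [Measure.restrict_apply measurableSet_closedBall.compl]; simp⟩)
  rw [mem_union, not_or, notMem_compl_iff] at hw
  refine ⟨w, hw.1, hw.2, ?_⟩
  rw [one_div, ENNReal.le_rpow_inv_iff hr]
  exact hle

/-- The pointwise bound obtained by chaining through shrinking balls. -/
theorem IsGradientOff.enorm_sub_le_tsum {n : ℕ} {s r : ℝ} (hs : 0 < s) (hs1 : s ≤ 1) (hr : 0 < r)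
    {f : Rn n → ℂ} {G : Rn n → ℝ≥0∞} {E : Set (Rn n)} (hG : IsGradientOff s f G E)
    {y z : Rn n} (hy : y ∉ E) (hz : z ∉ E) {j : ℤ} (hd : dist y z ≤ 2 * 2 ^ j) :
    ‖f y - f z‖ₑ ≤ 3 * 2 ^ ((j : ℝ) * s) * G z + 6 * ∑' i : ℕ, 2 ^ (((j - i : ℤ) : ℝ) * s) *
      (⨍⁻ u in closedBall y ((2 : ℝ) ^ (j - i : ℤ)), G u ^ r ∂volume) ^ (1 / r) := by
  set a : ℕ → ℝ≥0∞ := fun i =>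
    (⨍⁻ u in closedBall y ((2 : ℝ) ^ (j - i : ℤ)), G u ^ r ∂volume) ^ (1 / r) with ha
  set σ : ℕ → ℝ≥0∞ := fun i => 2 ^ (((j - i : ℤ) : ℝ) * s) with hσ
  choose w hwE hwd hwa using fun i : ℕ =>
    hG.exists_le_average hr y (show (0 : ℝ) < 2 ^ (j - i : ℤ) by positivity)
  have hσ0 : σ 0 = 2 ^ ((j : ℝ) * s) := by simp [hσ]
  have hσs : ∀ i, σ i ≤ 2 * σ (i + 1) := fun i => by
    have e : ((j - (i : ℕ) : ℤ) : ℝ) * s = s + ((j - (i + 1 : ℕ) : ℤ) : ℝ) * s := by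
      push_cast; ring
    simp only [hσ]
    rw [e, two_rpow_add]
    gcongr
    calc (2 : ℝ≥0∞) ^ s ≤ 2 ^ (1 : ℝ) := ENNReal.rpow_le_rpow_of_exponent_le (by norm_num) hs1
      _ = 2 := ENNReal.rpow_one 2
  have hρ : ∀ i : ℕ, (2 : ℝ) ^ (j - (i + 1 : ℕ) : ℤ) ≤ 2 ^ (j - (i : ℕ) : ℤ) := fun i =>
    zpow_le_zpow_right₀ (by norm_num) (by push_cast; linarith)
  -- The term `4 * (σ I * a I)` closes the induction: a step costs `2 * σ I * (a (I + 1) + a I)`,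
  -- where the `a I` part raises 4 to 6, and `σ I ≤ 2 * σ (I + 1)` turns the other part into the new
  -- term with coefficient 4.
  have hchain : ∀ I : ℕ, ‖f (w I) - f z‖ₑ ≤
      3 * σ 0 * G z + 6 * ∑ i ∈ Finset.range I, σ i * a i + 4 * (σ I * a I) := by
    intro I
    induction I with
    | zero =>
      have h1 := hwd 0
      simp only [Nat.cast_zero, sub_zero] at h1
      have := hG.enorm_sub_le hs hs1 (hwE 0) hz (c := 3) (by norm_num) (j := j)
        ((dist_triangle _ y _).trans (by linarith))
      rw [ENNReal.ofReal_ofNat, ← hσ0] at this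
      simp only [Finset.range_zero, Finset.sum_empty, mul_zero, add_zero]
      calc _ ≤ _ := this
        _ ≤ 3 * σ 0 * (a 0 + G z) := by gcongr; exact hwa 0
        _ = 3 * σ 0 * G z + 3 * (σ 0 * a 0) := by ring
        _ ≤ _ := by gcongr; norm_num
    | succ I ih =>
      have h1 := hwd I
      have h2 := hwd (I + 1)
      have h3 := hρ I
      have := hG.enorm_sub_le hs hs1 (hwE (I + 1)) (hwE I) (c := 2) (by norm_num)
        (j := j - (I : ℕ)) ((dist_triangle_right _ _ y).trans (by linarith))
      rw [ENNReal.ofReal_ofNat] at this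
      calc ‖f (w (I + 1)) - f z‖ₑ = ‖(f (w (I + 1)) - f (w I)) + (f (w I) - f z)‖ₑ := by
            rw [sub_add_sub_cancel]
        _ ≤ ‖f (w (I + 1)) - f (w I)‖ₑ + ‖f (w I) - f z‖ₑ := enorm_add_le _ _
        _ ≤ 2 * σ I * (a (I + 1) + a I) +
            (3 * σ 0 * G z + 6 * ∑ i ∈ Finset.range I, σ i * a i + 4 * (σ I * a I)) := by
            gcongr
            exact this.trans (mul_le_mul_right (add_le_add (hwa (I + 1)) (hwa I)) _)
        _ = 3 * σ 0 * G z + 6 * (∑ i ∈ Finset.range I, σ i * a i + σ I * a I)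
            + 2 * (σ I * a (I + 1)) := by ring
        _ ≤ 3 * σ 0 * G z + 6 * (∑ i ∈ Finset.range I, σ i * a i + σ I * a I)
            + 2 * (2 * σ (I + 1) * a (I + 1)) := by gcongr; exact hσs I
        _ = _ := by rw [Finset.sum_range_succ]; ring
  have hI : ∀ I : ℕ, ‖f y - f z‖ₑ ≤
      3 * σ 0 * G z + 6 * ∑' i, σ i * a i + σ I * G y := by
    intro I
    have h1 : dist y (w I) ≤ 1 * 2 ^ (j - (I : ℕ) : ℤ) := by
      rw [one_mul, dist_comm]; exact hwd I
    have := hG.enorm_sub_le hs hs1 hy (hwE I) le_rfl h1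
    rw [ENNReal.ofReal_one, one_mul] at this
    calc ‖f y - f z‖ₑ = ‖(f y - f (w I)) + (f (w I) - f z)‖ₑ := by rw [sub_add_sub_cancel]
      _ ≤ ‖f y - f (w I)‖ₑ + ‖f (w I) - f z‖ₑ := enorm_add_le _ _
      _ ≤ σ I * (G y + a I) +
          (3 * σ 0 * G z + 6 * ∑ i ∈ Finset.range I, σ i * a i + 4 * (σ I * a I)) :=
          add_le_add (this.trans (mul_le_mul_right (add_le_add_right (hwa I) _) _)) (hchain I)
      _ = 3 * σ 0 * G z + (6 * ∑ i ∈ Finset.range I, σ i * a i + 5 * (σ I * a I))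
          + σ I * G y := by ring
      _ ≤ 3 * σ 0 * G z + (6 * ∑ i ∈ Finset.range I, σ i * a i + 6 * (σ I * a I))
          + σ I * G y := by gcongr; norm_num
      _ = 3 * σ 0 * G z + 6 * ∑ i ∈ Finset.range (I + 1), σ i * a i + σ I * G y := by
          rw [Finset.sum_range_succ]; ring
      _ ≤ _ := by gcongr; exact ENNReal.sum_le_tsum _
  rw [← hσ0]
  -- The last link of the chain costs `σ I * G y`, which tends to zero because `G y` is finite off
  -- `E`. Hence no Lebesgue point argument is needed for `f`.
  have hlim : Filter.Tendsto (fun I => 3 * σ 0 * G z + 6 * ∑' i, σ i * a i + σ I * G y)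
      Filter.atTop (nhds (3 * σ 0 * G z + 6 * ∑' i, σ i * a i + 0 * G y)) := by
    refine Filter.Tendsto.add tendsto_const_nhds
      (ENNReal.Tendsto.mul_const ?_ (Or.inr (hG.ne_top y hy)))
    have : ∀ i : ℕ, σ i = σ 0 * ((2 : ℝ≥0∞) ^ (-s)) ^ i := fun i => by
      rw [hσ0, ← ENNReal.rpow_natCast, ← ENNReal.rpow_mul, ← two_rpow_add]
      simp only [hσ]
      congr 1
      push_cast; ring
    rw [funext this, ← mul_zero (σ 0)]
    refine ENNReal.Tendsto.const_mul (ENNReal.tendsto_pow_atTop_nhds_zero_of_lt_one ?_)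
      (Or.inr (two_rpow_ne_top _))
    exact ENNReal.rpow_lt_one_of_one_lt_of_neg (by norm_num) (by linarith)
  rw [zero_mul, add_zero] at hlim
  exact ge_of_tendsto' hlim hI

/-- The small ball lies in the ball of radius `2 ^ (j + 1)` about `x`, and `2 ^ ((i + 1) * n)` is
the ratio of the volumes. -/
theorem setLAverage_closedBall_le_dyadicMaximal {n : ℕ} (h : Rn n → ℝ≥0∞) {x y : Rn n} {j : ℤ}
    (hy : y ∈ closedBall x ((2 : ℝ) ^ j)) (i : ℕ) :
    ⨍⁻ u in closedBall y ((2 : ℝ) ^ (j - i : ℤ)), h u ∂volume ≤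
      2 ^ (((i : ℝ) + 1) * n) * dyadicMaximal h x := by
  rw [setLAverage_eq]
  refine ENNReal.div_le_of_le_mul ?_
  calc ∫⁻ u in closedBall y ((2 : ℝ) ^ (j - i : ℤ)), h u
      ≤ ∫⁻ u in closedBall x ((2 : ℝ) ^ (j + 1)), h u := by
        refine lintegral_mono_set (closedBall_subset_closedBall' ?_)
        have h1 : (2 : ℝ) ^ (j - i : ℤ) ≤ 2 ^ j :=
          zpow_le_zpow_right₀ (by norm_num) (by linarith [Int.natCast_nonneg i])
        rw [zpow_add_one₀ (by norm_num)]
        linarith [mem_closedBall.1 hy]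
    _ ≤ volume (closedBall x ((2 : ℝ) ^ (j + 1))) * dyadicMaximal h x :=
        setLIntegral_closedBall_le_dyadicMaximal h x _
    _ = _ := by
        rw [volume_closedBall_two_zpow, volume_closedBall_two_zpow y,
          show ((j + 1 : ℤ) : ℝ) * n = ((i : ℝ) + 1) * n + ((j - i : ℤ) : ℝ) * n by
            push_cast; ring, two_rpow_add]
        ring

/-- By Tonelli, a point `u` is counted with the measure of those `y` in the large ball that lie
within `ρ` of `u`; there are none unless `u` is in the ball of radius `2 * R`. -/
theorem lintegral_setLIntegral_closedBall_le {n : ℕ} {h : Rn n → ℝ≥0∞} (hh : Measurable h)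
    (x : Rn n) {ρ R : ℝ} (hρ : 0 ≤ ρ) (hρR : ρ ≤ R) :
    ∫⁻ y in closedBall x R, ∫⁻ u in closedBall y ρ, h u ≤
      volume (closedBall x ρ) * ∫⁻ u in closedBall x (2 * R), h u := by
  have e : ∀ y, ∫⁻ u in closedBall y ρ, h u =
      ∫⁻ u, {q : Rn n × Rn n | dist q.2 q.1 ≤ ρ}.indicator (fun q => h q.2) (y, u) := fun y => by
    rw [← lintegral_indicator measurableSet_closedBall]
    rfl
  simp_rw [e]
  rw [lintegral_lintegral_swap]
  · rw [← lintegral_const_mul' _ _ (volume_closedBall_ne_top x ρ),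
      ← lintegral_indicator measurableSet_closedBall]
    refine lintegral_mono fun u => ?_
    have : ∫⁻ y in closedBall x R, {q : Rn n × Rn n | dist q.2 q.1 ≤ ρ}.indicator
        (fun q => h q.2) (y, u) = h u * volume (closedBall u ρ ∩ closedBall x R) := by
      have e' : ∀ y, {q : Rn n × Rn n | dist q.2 q.1 ≤ ρ}.indicator (fun q => h q.2) (y, u) =
          (closedBall u ρ).indicator (fun _ => h u) y := fun y => by
        simp only [indicator, mem_closedBall, dist_comm y u]
        rfl
      simp_rw [e']
      rw [lintegral_indicator measurableSet_closedBall, setLIntegral_const,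
        Measure.restrict_apply measurableSet_closedBall]
    rw [this]
    by_cases hu : u ∈ closedBall x (2 * R)
    · rw [indicator_of_mem hu, mul_comm]
      refine mul_le_mul_left ?_ _
      rw [volume_closedBall_eq x hρ, ← volume_closedBall_eq u hρ]
      exact measure_mono inter_subset_left
    · rw [indicator_of_notMem hu]
      have : closedBall u ρ ∩ closedBall x R = ∅ := by
        rw [eq_empty_iff_forall_notMem]
        rintro y ⟨h1, h2⟩
        refine hu (mem_closedBall.2 ?_)
        have := dist_triangle_left u x y
        linarith [mem_closedBall.1 h1, mem_closedBall.1 h2]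
      simp [this]
  · refine Measurable.aemeasurable (Measurable.indicator (hh.comp measurable_snd) ?_)
    exact measurableSet_le (measurable_snd.dist measurable_fst) measurable_const

/-- Write `a ^ (1 / r)` as `a ^ (1 / r - 1) * a`. The first factor is bounded pointwise by the
maximal function at `x`, with the loss `2 ^ ((i + 1) * n * (1 / r - 1))`; the second is integrated
by Tonelli with a loss independent of `i`. A pointwise bound of the whole power would lose `2 ^ (i *
n / r)`, which is too much. -/
theorem lintegral_average_rpow_le {n : ℕ} {r : ℝ} (hr : 0 < r) (hr1 : r ≤ 1)
    {h : Rn n → ℝ≥0∞} (hh : Measurable h) (x : Rn n) (j : ℤ) (i : ℕ) :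
    ∫⁻ y in closedBall x ((2 : ℝ) ^ j),
      (⨍⁻ u in closedBall y ((2 : ℝ) ^ (j - i : ℤ)), h u ∂volume) ^ (1 / r) ≤
    2 ^ (((i : ℝ) + 1) * (n * (1 / r - 1)) + n) * volume (closedBall x ((2 : ℝ) ^ j)) *
      dyadicMaximal h x ^ (1 / r) := by
  have hr' : 0 ≤ 1 / r - 1 := by
    rw [sub_nonneg, le_div_iff₀ hr]
    linarith
  have split : ∀ a : ℝ≥0∞, a ^ (1 / r) = a ^ (1 / r - 1) * a := fun a => by
    conv_rhs => rw [← ENNReal.rpow_one a, ← ENNReal.rpow_mul, one_mul]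
    rw [← ENNReal.rpow_add_of_nonneg _ _ hr' zero_le_one, sub_add_cancel]
  set v := volume (closedBall x ((2 : ℝ) ^ (j - i : ℤ))) with hv
  have hv0 : v ≠ 0 := volume_closedBall_ne_zero x (by positivity)
  have hvt : v ≠ ∞ := volume_closedBall_ne_top x _
  have hvy : ∀ y : Rn n, volume (closedBall y ((2 : ℝ) ^ (j - i : ℤ))) = v := fun y => by
    rw [hv, volume_closedBall_two_zpow, volume_closedBall_two_zpow]
  have hmeas := measurable_setLIntegral_closedBall hh ((2 : ℝ) ^ (j - i : ℤ))
  calc _ ≤ ∫⁻ y in closedBall x ((2 : ℝ) ^ j),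
        (2 ^ (((i : ℝ) + 1) * n) * dyadicMaximal h x) ^ (1 / r - 1) * v⁻¹ *
          ∫⁻ u in closedBall y ((2 : ℝ) ^ (j - i : ℤ)), h u := by
        refine setLIntegral_mono' measurableSet_closedBall fun y hy => ?_
        rw [split, mul_assoc]
        refine mul_le_mul' (ENNReal.rpow_le_rpow
          (setLAverage_closedBall_le_dyadicMaximal h hy i) hr') ?_
        rw [setLAverage_eq, hvy, ENNReal.div_eq_inv_mul]
    _ = (2 ^ (((i : ℝ) + 1) * n) * dyadicMaximal h x) ^ (1 / r - 1) * v⁻¹ *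
        ∫⁻ y in closedBall x ((2 : ℝ) ^ j),
          ∫⁻ u in closedBall y ((2 : ℝ) ^ (j - i : ℤ)), h u := by
        rw [lintegral_const_mul _ hmeas]
    _ ≤ (2 ^ (((i : ℝ) + 1) * n) * dyadicMaximal h x) ^ (1 / r - 1) * v⁻¹ *
        (v * (volume (closedBall x ((2 : ℝ) ^ (j + 1))) * dyadicMaximal h x)) := by
        refine mul_le_mul_right ((lintegral_setLIntegral_closedBall_le hh x (by positivity)
          (zpow_le_zpow_right₀ (by norm_num) (by linarith [Int.natCast_nonneg i]))).trans ?_) _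
        refine mul_le_mul_right ?_ _
        rw [show (2 : ℝ) * 2 ^ j = 2 ^ (j + 1) by rw [zpow_add_one₀ (by norm_num), mul_comm]]
        exact setLIntegral_closedBall_le_dyadicMaximal h x _
    _ = 2 ^ ((((i : ℝ) + 1) * n) * (1 / r - 1)) * volume (closedBall x ((2 : ℝ) ^ (j + 1))) *
        (v⁻¹ * v) * (dyadicMaximal h x ^ (1 / r - 1) * dyadicMaximal h x) := by
        rw [ENNReal.mul_rpow_of_nonneg _ _ hr', ← ENNReal.rpow_mul]
        ring
    _ = _ := by
        rw [ENNReal.inv_mul_cancel hv0 hvt, mul_one, ← split, volume_closedBall_two_zpow,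
          volume_closedBall_two_zpow, two_rpow_add,
          show ((j + 1 : ℤ) : ℝ) * n = n + (j : ℝ) * n by push_cast; ring, two_rpow_add,
          show ((i : ℝ) + 1) * n * (1 / r - 1) = ((i : ℝ) + 1) * (n * (1 / r - 1)) by ring]
        ring

theorem tsum_two_rpow_neg {δ : ℝ} (hδ : 0 < δ) : ∑' i : ℕ, (2 : ℝ≥0∞) ^ (-(i * δ)) ≠ ∞ := by
  have : ∀ i : ℕ, (2 : ℝ≥0∞) ^ (-(i * δ)) = ((2 : ℝ≥0∞) ^ (-δ)) ^ i := fun i => by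
    rw [← ENNReal.rpow_natCast, ← ENNReal.rpow_mul]
    congr 1
    ring
  simp_rw [this]
  rw [ENNReal.tsum_geometric]
  have : (2 : ℝ≥0∞) ^ (-δ) < 1 :=
    ENNReal.rpow_lt_one_of_one_lt_of_neg (by norm_num) (by linarith)
  exact ENNReal.inv_ne_top.2 (tsub_pos_of_lt this).ne'

/-- The Poincaré inequality, with the oscillation measured from a point off the exceptional
set. -/
theorem exists_setLIntegral_enorm_sub_le {n : ℕ} {s r : ℝ} (hs : 0 < s) (hs1 : s ≤ 1)
    (hr : 0 < r) (hr1 : r ≤ 1) (hrs : n * (1 / r - 1) < s) :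
    ∃ C : ℝ≥0, ∀ (f : Rn n → ℂ) (G : Rn n → ℝ≥0∞) (E : Set (Rn n)), IsGradientOff s f G E →
      ∀ (x z : Rn n) (j : ℤ), z ∉ E → z ∈ closedBall x ((2 : ℝ) ^ j) →
        ∫⁻ y in closedBall x ((2 : ℝ) ^ j), ‖f y - f z‖ₑ ≤
          C * 2 ^ ((j : ℝ) * (n + s)) * (maximalPow r G x + G z) := by
  set δ := s - n * (1 / r - 1)
  have hδ : 0 < δ := by linarith
  set A := ∑' i : ℕ, (2 : ℝ≥0∞) ^ (-(i * δ)) with hA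
  have hAt : A ≠ ∞ := tsum_two_rpow_neg hδ
  set ω := volume (ball (0 : Rn n) 1) with hω
  have hωt : ω ≠ ∞ := measure_ball_lt_top.ne
  set K : ℝ≥0∞ := (3 + 6 * (2 ^ (n * (1 / r - 1) + n) * A)) * ω with hK
  have hKt : K ≠ ∞ := by finiteness
  refine ⟨K.toNNReal, fun f G E hG x z j hz hzx => ?_⟩
  rw [ENNReal.coe_toNNReal hKt]
  have hh : Measurable fun y => G y ^ r := hG.measurable.pow_const r
  set a : ℕ → Rn n → ℝ≥0∞ := fun i y =>
    (⨍⁻ u in closedBall y ((2 : ℝ) ^ (j - i : ℤ)), G u ^ r ∂volume) ^ (1 / r) with ha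
  have hma : ∀ i, Measurable (a i) := fun i => by
    have : (fun y : Rn n => ⨍⁻ u in closedBall y ((2 : ℝ) ^ (j - i : ℤ)), G u ^ r ∂volume) =
        fun y => (∫⁻ u in closedBall y ((2 : ℝ) ^ (j - i : ℤ)), G u ^ r) /
          volume (closedBall (0 : Rn n) ((2 : ℝ) ^ (j - i : ℤ))) := by
      ext y
      rw [setLAverage_eq, volume_closedBall_two_zpow, volume_closedBall_two_zpow]
    simp only [ha]
    refine Measurable.pow_const ?_ _
    rw [this]
    exact (measurable_setLIntegral_closedBall hh _).div_const _
  have hae : ∀ᵐ y ∂(volume.restrict (closedBall x ((2 : ℝ) ^ j))), ‖f y - f z‖ₑ ≤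
      3 * 2 ^ ((j : ℝ) * s) * G z + 6 * ∑' i : ℕ, 2 ^ (((j - i : ℤ) : ℝ) * s) * a i y := by
    filter_upwards [ae_restrict_mem measurableSet_closedBall,
      ae_restrict_of_ae (measure_eq_zero_iff_ae_notMem.1 hG.null)] with y hyx hyE
    refine hG.enorm_sub_le_tsum hs hs1 hr hyE hz ?_
    have := dist_triangle_right y z x
    linarith [mem_closedBall.1 hyx, mem_closedBall.1 hzx]
  calc _ ≤ _ := lintegral_mono_ae hae
    _ = 3 * 2 ^ ((j : ℝ) * s) * G z * volume (closedBall x ((2 : ℝ) ^ j)) +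
        6 * ∑' i : ℕ, 2 ^ (((j - i : ℤ) : ℝ) * s) *
          ∫⁻ y in closedBall x ((2 : ℝ) ^ j), a i y := by
        rw [lintegral_add_left measurable_const, setLIntegral_const,
          lintegral_const_mul' _ _ (by finiteness),
          lintegral_tsum fun i => ((hma i).const_mul _).aemeasurable]
        congr 2
        refine tsum_congr fun i => ?_
        rw [lintegral_const_mul _ (hma i)]
    _ ≤ 3 * 2 ^ ((j : ℝ) * s) * G z * volume (closedBall x ((2 : ℝ) ^ j)) +
        6 * ∑' i : ℕ, 2 ^ (((j - i : ℤ) : ℝ) * s) *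
          (2 ^ (((i : ℝ) + 1) * (n * (1 / r - 1)) + n) * volume (closedBall x ((2 : ℝ) ^ j)) *
            maximalPow r G x) := by
        refine add_le_add_right (mul_le_mul_right (ENNReal.tsum_le_tsum fun i =>
          mul_le_mul_right ?_ _) _) _
        exact lintegral_average_rpow_le hr hr1 hh x j i
    _ = 3 * 2 ^ ((j : ℝ) * s) * G z * volume (closedBall x ((2 : ℝ) ^ j)) +
        6 * (2 ^ (n * (1 / r - 1) + n) * A) * 2 ^ ((j : ℝ) * s) *
          volume (closedBall x ((2 : ℝ) ^ j)) * maximalPow r G x := by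
        congr 1
        rw [hA, ← ENNReal.tsum_mul_left, ← ENNReal.tsum_mul_left, ← ENNReal.tsum_mul_left,
          ← ENNReal.tsum_mul_right, ← ENNReal.tsum_mul_right, ← ENNReal.tsum_mul_right]
        refine tsum_congr fun i => ?_
        -- The gain `2 ^ (-i * s)` against the loss `2 ^ (i * n * (1 / r - 1))` leaves the geometric
        -- factor `2 ^ (-i * δ)`.
        have : (2 : ℝ≥0∞) ^ (((j - i : ℤ) : ℝ) * s) *
            2 ^ (((i : ℝ) + 1) * (n * (1 / r - 1)) + n) =
            2 ^ (n * (1 / r - 1) + n) * 2 ^ (-(i * δ)) * 2 ^ ((j : ℝ) * s) := by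
          rw [← two_rpow_add, ← two_rpow_add, ← two_rpow_add]
          congr 1
          push_cast
          ring
        calc _ = 6 * ((2 : ℝ≥0∞) ^ (((j - i : ℤ) : ℝ) * s) *
            2 ^ (((i : ℝ) + 1) * (n * (1 / r - 1)) + n)) *
            volume (closedBall x ((2 : ℝ) ^ j)) * maximalPow r G x := by ring
          _ = _ := by rw [this]; ring
    _ = 2 ^ ((j : ℝ) * (n + s)) * ω * (6 * (2 ^ (n * (1 / r - 1) + n) * A) * maximalPow r G x +
          3 * G z) := by
        rw [volume_closedBall_two_zpow, mul_add (j : ℝ), two_rpow_add ((j : ℝ) * n), ← hω]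
        ring
    _ ≤ 2 ^ ((j : ℝ) * (n + s)) * ω * ((3 + 6 * (2 ^ (n * (1 / r - 1) + n) * A)) *
          maximalPow r G x + (3 + 6 * (2 ^ (n * (1 / r - 1) + n) * A)) * G z) := by
        gcongr
        · exact le_add_self
        · exact le_self_add
    _ = _ := by rw [hK]; ring

/-- The Poincaré inequality summed over dyadic annuli. -/
theorem exists_lintegral_enorm_sub_mul_rpow_le {n : ℕ} {s r q : ℝ} (hs : 0 < s) (hs1 : s ≤ 1)
    (hr : 0 < r) (hr1 : r ≤ 1) (hrs : n * (1 / r - 1) < s) (hq : n + s < q) :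
    ∃ C : ℝ≥0, ∀ (f : Rn n → ℂ) (G : Rn n → ℝ≥0∞) (E : Set (Rn n)), IsGradientOff s f G E →
      AEMeasurable f volume →
      ∀ (x z : Rn n) (k : ℤ), z ∉ E → z ∈ closedBall x ((2 : ℝ) ^ k) →
        ∫⁻ y, ‖f y - f z‖ₑ * ENNReal.ofReal ((1 + dist y x / 2 ^ k) ^ (-q)) ≤
          C * 2 ^ ((k : ℝ) * (n + s)) * (maximalPow r G x + G z) := by
  obtain ⟨C, hC⟩ := exists_setLIntegral_enorm_sub_le (n := n) hs hs1 hr hr1 hrs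
  set δ := q - (n + s)
  have hδ : 0 < δ := by linarith
  have hq0 : 0 < q := by linarith [Nat.cast_nonneg (α := ℝ) n]
  set A := ∑' i : ℕ, (2 : ℝ≥0∞) ^ (-(i * δ)) with hA
  have hAt : A ≠ ∞ := tsum_two_rpow_neg hδ
  set K : ℝ≥0∞ := 2 ^ q * A * C with hK
  have hKt : K ≠ ∞ := by finiteness
  refine ⟨K.toNNReal, fun f G E hG hf x z k hz hzx => ?_⟩
  rw [ENNReal.coe_toNNReal hKt]
  have hmf : AEMeasurable (fun y => ‖f y - f z‖ₑ) volume := (hf.sub_const _).enorm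
  -- Only the term with the least `i` whose ball contains `y` is used. For `i > 0` the previous ball
  -- misses `y`, so the base of the weight is at least `2 ^ (i - 1)`; the constant `2 ^ q` pays for
  -- this shift and also covers `i = 0`.
  have hweight : ∀ y : Rn n, ENNReal.ofReal ((1 + dist y x / 2 ^ k) ^ (-q)) ≤
      ∑' i : ℕ, 2 ^ q * 2 ^ (-(i * q)) *
        (closedBall x ((2 : ℝ) ^ (k + i : ℤ))).indicator (fun _ => (1 : ℝ≥0∞)) y := by
    intro y
    have h1 : (1 : ℝ) ≤ 1 + dist y x / 2 ^ k := by
      have : 0 ≤ dist y x / 2 ^ k := by positivity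
      linarith
    have hex : ∃ i : ℕ, dist y x ≤ 2 ^ (k + i : ℤ) := by
      obtain ⟨i, hi⟩ := pow_unbounded_of_one_lt (dist y x / 2 ^ k) (one_lt_two (α := ℝ))
      refine ⟨i, ?_⟩
      rw [zpow_add₀ (by norm_num), zpow_natCast, mul_comm]
      exact ((div_lt_iff₀ (by positivity)).1 hi).le
    classical
    set i := Nat.find hex with hi
    have hyi : y ∈ closedBall x ((2 : ℝ) ^ (k + i : ℤ)) := Nat.find_spec hex
    refine le_trans ?_ (ENNReal.le_tsum i)
    rw [indicator_of_mem hyi, mul_one, ← two_rpow_add]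
    rcases Nat.eq_zero_or_pos i with h0 | hpos
    · rw [h0]
      simp only [Nat.cast_zero, zero_mul, neg_zero, add_zero]
      calc _ ≤ ENNReal.ofReal 1 := ENNReal.ofReal_le_ofReal
            (Real.rpow_le_one_of_one_le_of_nonpos h1 (by linarith))
        _ = 2 ^ (0 : ℝ) := by simp
        _ ≤ 2 ^ q := ENNReal.rpow_le_rpow_of_exponent_le (by norm_num) hq0.le
    · have hlt := Nat.find_min hex (m := i - 1) (by omega)
      rw [not_le] at hlt
      have hge : (2 : ℝ) ^ ((i : ℤ) - 1) ≤ 1 + dist y x / 2 ^ k := by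
        have h2 : (2 : ℝ) ^ ((i : ℤ) - 1) ≤ dist y x / 2 ^ k := by
          rw [le_div_iff₀ (by positivity), ← zpow_add₀ (by norm_num)]
          convert hlt.le using 2
          push_cast [Nat.cast_sub (show 1 ≤ i from hpos)]
          ring
        linarith
      calc _ ≤ ENNReal.ofReal (((2 : ℝ) ^ ((i : ℤ) - 1)) ^ (-q)) :=
            ENNReal.ofReal_le_ofReal
              (Real.rpow_le_rpow_of_nonpos (by positivity) hge (by linarith))
        _ = _ := by
          rw [ofReal_two_zpow_rpow]
          congr 1
          push_cast
          ring
  calc _ ≤ ∫⁻ y, ∑' i : ℕ, 2 ^ q * 2 ^ (-(i * q)) *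
        (closedBall x ((2 : ℝ) ^ (k + i : ℤ))).indicator (fun y => ‖f y - f z‖ₑ) y := by
        refine lintegral_mono fun y => ?_
        calc _ ≤ _ := mul_le_mul_right (hweight y) _
          _ = _ := by
            rw [← ENNReal.tsum_mul_left]
            refine tsum_congr fun i => ?_
            by_cases hy : y ∈ closedBall x ((2 : ℝ) ^ (k + i : ℤ))
            · rw [indicator_of_mem hy, indicator_of_mem hy]; ring
            · rw [indicator_of_notMem hy, indicator_of_notMem hy]; ring
    _ = ∑' i : ℕ, 2 ^ q * 2 ^ (-(i * q)) *
        ∫⁻ y in closedBall x ((2 : ℝ) ^ (k + i : ℤ)), ‖f y - f z‖ₑ := by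
        rw [lintegral_tsum fun i => (hmf.indicator measurableSet_closedBall).const_mul _]
        refine tsum_congr fun i => ?_
        rw [lintegral_const_mul' _ _ (ENNReal.mul_ne_top (two_rpow_ne_top _) (two_rpow_ne_top _)),
          lintegral_indicator measurableSet_closedBall]
    _ ≤ ∑' i : ℕ, 2 ^ q * 2 ^ (-(i * q)) *
        (C * 2 ^ (((k + i : ℤ) : ℝ) * (n + s)) * (maximalPow r G x + G z)) := by
        -- The same `z` serves for all the larger balls, so no telescoping between means over
        -- different balls is required.
        refine ENNReal.tsum_le_tsum fun i => mul_le_mul_right (hC f G E hG x z _ hz ?_) _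
        refine closedBall_subset_closedBall (zpow_le_zpow_right₀ (by norm_num) ?_) hzx
        linarith [Int.natCast_nonneg i]
    _ = _ := by
        rw [hK, hA, ← ENNReal.tsum_mul_left, ← ENNReal.tsum_mul_right, ← ENNReal.tsum_mul_right,
          ← ENNReal.tsum_mul_right]
        refine tsum_congr fun i => ?_
        have : (2 : ℝ≥0∞) ^ (-(i * q)) * 2 ^ (((k + i : ℤ) : ℝ) * (n + s)) =
            2 ^ (-(i * δ)) * 2 ^ ((k : ℝ) * (n + s)) := by
          rw [← two_rpow_add, ← two_rpow_add]
          congr 1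
          push_cast
          ring
        calc _ = 2 ^ q * ((2 : ℝ≥0∞) ^ (-(i * q)) * 2 ^ (((k + i : ℤ) : ℝ) * (n + s))) * C *
              (maximalPow r G x + G z) := by ring
          _ = _ := by rw [this]; ring

/-- The maximal function of order `r` is bounded on `L^p` for `r < p`. -/
theorem exists_lintegral_maximalPow_rpow_le (n : ℕ) {r p : ℝ} (hr : 0 < r) (hrp : r < p) :
    ∃ C : ℝ≥0, ∀ G : Rn n → ℝ≥0∞, Measurable G →
      ∫⁻ x, maximalPow r G x ^ p ≤ C * ∫⁻ x, G x ^ p := by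
  obtain ⟨C, hC⟩ := exists_lintegral_dyadicMaximal_rpow_le n ((one_lt_div hr).2 hrp)
  refine ⟨C, fun G hG => ?_⟩
  have h1 : ∀ x, maximalPow r G x ^ p = dyadicMaximal (fun y => G y ^ r) x ^ (p / r) :=
    fun x => by
      rw [maximalPow, ← ENNReal.rpow_mul, one_div_mul_eq_div]
  have h2 : ∀ x, G x ^ p = (G x ^ r) ^ (p / r) := fun x => by
    rw [← ENNReal.rpow_mul, mul_div_cancel₀ _ hr.ne']
  simp_rw [h1, h2]
  exact hC (fun y => G y ^ r) (hG.pow_const r)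

/-! ### Translations of Schwartz functions -/

section Translation

variable {n : ℕ} {F : Type} [NormedAddCommGroup F] [NormedSpace ℝ F]

/-- This is Peetre's inequality `1 + ‖y‖ ≤ (1 + ‖y - z‖) * (1 + ‖z‖)`: translating by `z` costs only
a power of `1 + ‖z‖`. -/
theorem one_add_norm_pow_mul_iteratedFDeriv_comp_sub_le (a b : ℕ) (φ : 𝓢(Rn n, F)) :
    ∃ C : ℝ, 0 ≤ C ∧ ∀ y z : Rn n,
      (1 + ‖y‖) ^ a * ‖iteratedFDeriv ℝ b φ (y - z)‖ ≤ C * (1 + ‖z‖) ^ a := by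
  refine ⟨2 ^ a * ((Finset.Iic (a, b)).sup fun m => SchwartzMap.seminorm ℝ m.1 m.2) φ,
    by positivity, fun y z => ?_⟩
  have h := SchwartzMap.one_add_le_sup_seminorm_apply (𝕜 := ℝ) (m := (a, b)) le_rfl le_rfl φ
    (y - z)
  have h1 : 1 + ‖y‖ ≤ (1 + ‖y - z‖) * (1 + ‖z‖) := by
    have := norm_add_le (y - z) z
    rw [sub_add_cancel] at this
    nlinarith [mul_nonneg (norm_nonneg (y - z)) (norm_nonneg z)]
  calc (1 + ‖y‖) ^ a * ‖iteratedFDeriv ℝ b φ (y - z)‖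
      ≤ ((1 + ‖y - z‖) * (1 + ‖z‖)) ^ a * ‖iteratedFDeriv ℝ b φ (y - z)‖ := by gcongr
    _ = (1 + ‖y - z‖) ^ a * ‖iteratedFDeriv ℝ b φ (y - z)‖ * (1 + ‖z‖) ^ a := by
        rw [mul_pow]; ring
    _ ≤ _ := by gcongr

/-- The mean value inequality in the translation parameter, with the derivative of order `b + 1`
bounded by the preceding lemma. It yields both the continuity of translation in the Schwartz
topology and the Lipschitz bound for test functions. -/
theorem one_add_norm_pow_mul_iteratedFDeriv_sub_le (a b : ℕ) (φ : 𝓢(Rn n, F)) (R : ℝ) :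
    ∃ C : ℝ, 0 ≤ C ∧ ∀ y : Rn n, ∀ z ∈ closedBall (0 : Rn n) R, ∀ z' ∈ closedBall (0 : Rn n) R,
      (1 + ‖y‖) ^ a * ‖iteratedFDeriv ℝ b φ (y - z) - iteratedFDeriv ℝ b φ (y - z')‖ ≤
        C * ‖z - z'‖ := by
  obtain ⟨C, hC0, hC⟩ := one_add_norm_pow_mul_iteratedFDeriv_comp_sub_le a (b + 1) φ
  refine ⟨C * (1 + |R|) ^ a, by positivity, fun y z hz z' hz' => ?_⟩
  have hy : 0 < (1 + ‖y‖) ^ a := by positivity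
  have key := Convex.norm_image_sub_le_of_norm_hasFDerivWithin_le (𝕜 := ℝ)
    (f := fun w => iteratedFDeriv ℝ b φ (y - w))
    (f' := fun w => (fderiv ℝ (iteratedFDeriv ℝ b φ) (y - w)).comp
      (-ContinuousLinearMap.id ℝ (Rn n)))
    (C := C * (1 + |R|) ^ a / (1 + ‖y‖) ^ a)
    (s := closedBall (0 : Rn n) R) (x := z') (y := z) (fun w _ => ?_) (fun w hw => ?_)
    (convex_closedBall _ _) hz' hz
  · rw [div_mul_eq_mul_div, le_div_iff₀ hy] at key
    linarith
  · have h1 : DifferentiableAt ℝ (iteratedFDeriv ℝ b φ) (y - w) :=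
      (φ.smooth ⊤).differentiable_iteratedFDeriv (by exact_mod_cast ENat.natCast_lt_top b) _
    have h2 : HasFDerivAt (fun w : Rn n => y - w) (-ContinuousLinearMap.id ℝ (Rn n)) w :=
      (hasFDerivAt_id w).const_sub y
    exact (h1.hasFDerivAt.comp w h2).hasFDerivWithinAt
  · rw [le_div_iff₀ hy]
    have h1 : ‖(fderiv ℝ (iteratedFDeriv ℝ b φ) (y - w)).comp
        (-ContinuousLinearMap.id ℝ (Rn n))‖ ≤ ‖iteratedFDeriv ℝ (b + 1) φ (y - w)‖ := by
      rw [← norm_fderiv_iteratedFDeriv, ContinuousLinearMap.comp_neg,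
        ContinuousLinearMap.comp_id]
      exact (norm_neg (fderiv ℝ (iteratedFDeriv ℝ b φ) (y - w))).le
    have h2 : ‖w‖ ≤ |R| := (mem_closedBall_zero_iff.1 hw).trans (le_abs_self R)
    calc _ ≤ ‖iteratedFDeriv ℝ (b + 1) φ (y - w)‖ * (1 + ‖y‖) ^ a := by gcongr
      _ = (1 + ‖y‖) ^ a * ‖iteratedFDeriv ℝ (b + 1) φ (y - w)‖ := mul_comm _ _
      _ ≤ C * (1 + ‖w‖) ^ a := hC y w
      _ ≤ _ := by gcongr

end Translation

section Translate

variable {n : ℕ}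

/-- The translate `y ↦ φ (y - z)`. -/
noncomputable abbrev translate (z : Rn n) (φ : 𝓢(Rn n, ℂ)) : 𝓢(Rn n, ℂ) :=
  SchwartzMap.compSubConstCLM ℂ z φ

theorem iteratedFDeriv_translate (b : ℕ) (z : Rn n) (φ : 𝓢(Rn n, ℂ)) (y : Rn n) :
    iteratedFDeriv ℝ b (translate z φ) y = iteratedFDeriv ℝ b φ (y - z) := by
  have : (translate z φ : Rn n → ℂ) = fun y => φ (y - z) := by
    ext y; simp
  rw [this, iteratedFDeriv_comp_sub]

theorem norm_pow_le_one_add_norm_pow (a : ℕ) (y : Rn n) : ‖y‖ ^ a ≤ (1 + ‖y‖) ^ a := by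
  gcongr
  linarith

theorem continuous_translate (φ : 𝓢(Rn n, ℂ)) : Continuous fun z => translate z φ := by
  rw [continuous_iff_continuousAt]
  intro z₀
  rw [ContinuousAt, (schwartz_withSeminorms ℂ (Rn n) ℂ).tendsto_nhds]
  rintro ⟨a, b⟩ ε hε
  obtain ⟨C, hC0, hC⟩ := one_add_norm_pow_mul_iteratedFDeriv_sub_le a b φ (‖z₀‖ + 1)
  have hlim : Filter.Tendsto (fun z => C * ‖z - z₀‖) (nhds z₀) (nhds 0) := by
    have : Continuous fun z => C * ‖z - z₀‖ := by fun_prop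
    simpa using this.tendsto z₀
  filter_upwards [hlim.eventually_lt_const hε, closedBall_mem_nhds z₀ one_pos] with z hz hz1
  refine lt_of_le_of_lt (SchwartzMap.seminorm_le_bound ℂ a b _ (by positivity) fun y => ?_) hz
  have e : iteratedFDeriv ℝ b (translate z φ - translate z₀ φ : 𝓢(Rn n, ℂ)) y =
      iteratedFDeriv ℝ b φ (y - z) - iteratedFDeriv ℝ b φ (y - z₀) := by
    rw [← iteratedFDeriv_translate, ← iteratedFDeriv_translate]
    exact iteratedFDeriv_sub_apply ((translate z φ).contDiffAt _)
      ((translate z₀ φ).contDiffAt _)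
  rw [e]
  refine le_trans ?_ (hC y z ?_ z₀ ?_)
  · exact mul_le_mul_of_nonneg_right (norm_pow_le_one_add_norm_pow a y) (norm_nonneg _)
  · rw [mem_closedBall_zero_iff]
    have h1 := norm_sub_norm_le z z₀
    have h2 := mem_closedBall_iff_norm.1 hz1
    linarith
  · rw [mem_closedBall_zero_iff]
    linarith

/-- Polynomial growth in `z` is what makes the translates integrable against a Schwartz function of
`z`. -/
theorem exists_seminorm_translate_le (φ : 𝓢(Rn n, ℂ)) (s : Finset (ℕ × ℕ)) :
    ∃ (C : ℝ) (N : ℕ), 0 ≤ C ∧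
      ∀ z, s.sup (schwartzSeminormFamily ℂ (Rn n) ℂ) (translate z φ) ≤ C * (1 + ‖z‖) ^ N := by
  choose C hC0 hC using fun i : ℕ × ℕ =>
    one_add_norm_pow_mul_iteratedFDeriv_comp_sub_le i.1 i.2 φ
  refine ⟨∑ i ∈ s, C i, s.sup Prod.fst, Finset.sum_nonneg fun i _ => hC0 i, fun z => ?_⟩
  have h1 : (1 : ℝ) ≤ 1 + ‖z‖ := by linarith [norm_nonneg z]
  refine Seminorm.finset_sup_apply_le
    (mul_nonneg (Finset.sum_nonneg fun i _ => hC0 i) (by positivity)) fun i hi => ?_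
  refine SchwartzMap.seminorm_le_bound ℂ i.1 i.2 _
    (mul_nonneg (Finset.sum_nonneg fun i _ => hC0 i) (by positivity)) fun y => ?_
  rw [iteratedFDeriv_translate]
  calc _ ≤ (1 + ‖y‖) ^ i.1 * ‖iteratedFDeriv ℝ i.2 φ (y - z)‖ :=
        mul_le_mul_of_nonneg_right (norm_pow_le_one_add_norm_pow _ y) (norm_nonneg _)
    _ ≤ C i * (1 + ‖z‖) ^ i.1 := hC i y z
    _ ≤ _ := by
        gcongr
        · exact Finset.sum_nonneg fun i _ => hC0 i
        · exact Finset.single_le_sum (fun i _ => hC0 i) hi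
        · exact Finset.le_sup (f := Prod.fst) hi

theorem exists_norm_le_sup_seminorm (T : 𝓢'(Rn n, ℂ)) :
    ∃ (s : Finset (ℕ × ℕ)) (C : ℝ), 0 ≤ C ∧
      ∀ φ : 𝓢(Rn n, ℂ), ‖T φ‖ ≤ C * s.sup (schwartzSeminormFamily ℂ (Rn n) ℂ) φ := by
  obtain ⟨s, C, -, h⟩ := Seminorm.bound_of_continuous (schwartz_withSeminorms ℂ (Rn n) ℂ)
    ((normSeminorm ℂ ℂ).comp T.toLinearMap) (continuous_norm.comp T.continuous)
  exact ⟨s, C, C.2, fun φ => h φ⟩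

theorem continuous_apply_translate (T : 𝓢'(Rn n, ℂ)) (φ : 𝓢(Rn n, ℂ)) :
    Continuous fun z => T (translate z φ) :=
  T.continuous.comp (continuous_translate φ)

theorem exists_norm_apply_translate_le (T : 𝓢'(Rn n, ℂ)) (φ : 𝓢(Rn n, ℂ)) :
    ∃ (C : ℝ) (N : ℕ), 0 ≤ C ∧ ∀ z, ‖T (translate z φ)‖ ≤ C * (1 + ‖z‖) ^ N := by
  obtain ⟨s, C, hC0, hC⟩ := exists_norm_le_sup_seminorm T
  obtain ⟨D, N, hD0, hD⟩ := exists_seminorm_translate_le φ s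
  refine ⟨C * D, N, by positivity, fun z => (hC _).trans ?_⟩
  rw [mul_assoc]
  gcongr
  exact hD z

theorem integrable_one_add_norm_pow_mul (φ : 𝓢(Rn n, ℂ)) (N : ℕ) :
    Integrable fun x => (1 + ‖x‖) ^ N * ‖φ x‖ := by
  have h := ((φ.integrable (μ := volume)).norm.add (φ.integrable_pow_mul volume N)).const_mul
    ((2 : ℝ) ^ N)
  refine h.mono' (by fun_prop) (Filter.Eventually.of_forall fun x => ?_)
  rw [Real.norm_of_nonneg (by positivity)]
  have : (1 + ‖x‖) ^ N ≤ 2 ^ N * (1 + ‖x‖ ^ N) := by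
    calc (1 + ‖x‖) ^ N ≤ 2 ^ (N - 1) * (1 ^ N + ‖x‖ ^ N) :=
          add_pow_le zero_le_one (norm_nonneg x) N
      _ ≤ 2 ^ N * (1 + ‖x‖ ^ N) := by
          rw [one_pow]
          gcongr
          · norm_num
          · omega
  calc _ ≤ 2 ^ N * (1 + ‖x‖ ^ N) * ‖φ x‖ := by gcongr
    _ = _ := by simp only [Pi.add_apply]; ring

end Translate

/-! ### The convolution of two Schwartz functions -/

section Convolution

variable {n : ℕ} {F : Type} [NormedAddCommGroup F] [NormedSpace ℝ F] [NormedSpace ℂ F]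

theorem integrable_smul_comp_sub {a : Rn n → ℂ} (ha : Integrable a) (b : 𝓢(Rn n, F)) (y : Rn n) :
    Integrable fun x => a x • b (y - x) := by
  refine ha.smul_bdd (C := SchwartzMap.seminorm ℝ 0 0 b) ?_ ?_
  · exact (b.continuous.comp (by fun_prop)).aestronglyMeasurable
  · exact Filter.Eventually.of_forall fun x => b.norm_le_seminorm ℝ _

theorem hasFDerivAt_integral_smul_comp_sub [SMulCommClass ℝ ℂ F] {a : Rn n → ℂ}
    (ha : Integrable a) (b : 𝓢(Rn n, F))
    (y : Rn n) :
    HasFDerivAt (fun y => ∫ x, a x • b (y - x))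
      (∫ x, a x • SchwartzMap.fderivCLM ℂ (Rn n) F b (y - x)) y := by
  refine hasFDerivAt_integral_of_dominated_of_fderiv_le (s := univ)
    (F' := fun y x => a x • SchwartzMap.fderivCLM ℂ (Rn n) F b (y - x))
    (bound := fun x => ‖a x‖ * SchwartzMap.seminorm ℝ 0 0 (SchwartzMap.fderivCLM ℂ (Rn n) F b))
    Filter.univ_mem
    (Filter.Eventually.of_forall fun y => (integrable_smul_comp_sub ha b y).aestronglyMeasurable)
    (integrable_smul_comp_sub ha b y)
    (integrable_smul_comp_sub ha (SchwartzMap.fderivCLM ℂ (Rn n) F b) y).aestronglyMeasurable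
    (Filter.Eventually.of_forall fun x y _ => ?_) (ha.norm.mul_const _)
    (Filter.Eventually.of_forall fun x y _ => ?_)
  · rw [norm_smul]
    gcongr
    exact SchwartzMap.norm_le_seminorm ℝ _ _
  · have h1 : HasFDerivAt (fun y : Rn n => y - x) (ContinuousLinearMap.id ℝ (Rn n)) y :=
      (hasFDerivAt_id y).sub_const x
    exact ((b.hasFDerivAt (y - x)).comp y h1).const_smul (a x)

/-- All derivatives fall on `b`. The codomain is quantified inside the statement because the
induction replaces `b` by its Fréchet derivative, which takes values in another space. -/
theorem contDiff_integral_smul_comp_sub {a : Rn n → ℂ} (ha : Integrable a) (k : ℕ) :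
    ∀ {F : Type} [NormedAddCommGroup F] [NormedSpace ℝ F] [NormedSpace ℂ F] [SMulCommClass ℝ ℂ F]
      (b : 𝓢(Rn n, F)), ContDiff ℝ k fun y => ∫ x, a x • b (y - x) := by
  induction k with
  | zero =>
    intro F _ _ _ _ b
    exact contDiff_zero.2 (continuous_iff_continuousAt.2 fun y =>
      (hasFDerivAt_integral_smul_comp_sub ha b y).continuousAt)
  | succ k ih =>
    intro F _ _ _ _ b
    exact contDiff_succ_iff_hasFDerivAt.2
      ⟨_, ih (SchwartzMap.fderivCLM ℂ (Rn n) F b), hasFDerivAt_integral_smul_comp_sub ha b⟩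

theorem iteratedFDeriv_integral_smul_comp_sub {a : Rn n → ℂ} (ha : Integrable a) (k : ℕ) :
    ∀ {F : Type} [NormedAddCommGroup F] [NormedSpace ℝ F] [NormedSpace ℂ F] [SMulCommClass ℝ ℂ F]
      (b : 𝓢(Rn n, F)) (y : Rn n), iteratedFDeriv ℝ k (fun y => ∫ x, a x • b (y - x)) y =
        ∫ x, a x • iteratedFDeriv ℝ k b (y - x) := by
  induction k with
  | zero =>
    intro F _ _ _ _ b y
    have : ∀ x, a x • iteratedFDeriv ℝ 0 b (y - x) =
        (continuousMultilinearCurryFin0 ℝ (Rn n) F).symm (a x • b (y - x)) := fun x => by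
      ext; simp
    simp_rw [this]
    rw [iteratedFDeriv_zero_eq_comp]
    exact ((continuousMultilinearCurryFin0 ℝ (Rn n) F).symm.toContinuousLinearEquiv.integral_comp_comm
      (μ := volume) (fun x => a x • b (y - x))).symm
  | succ k ih =>
    intro F _ _ _ _ b y
    have hb : (fun y => fderiv ℝ b y) = SchwartzMap.fderivCLM ℂ (Rn n) F b := by
      ext; simp
    have : ∀ x, a x • iteratedFDeriv ℝ (k + 1) b (y - x) =
        (continuousMultilinearCurryRightEquiv' ℝ k (Rn n) F).symm
          (a x • iteratedFDeriv ℝ k (SchwartzMap.fderivCLM ℂ (Rn n) F b) (y - x)) := fun x => by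
      rw [iteratedFDeriv_succ_eq_comp_right, hb]
      ext; simp
    simp_rw [this]
    rw [iteratedFDeriv_succ_eq_comp_right,
      funext fun y => (hasFDerivAt_integral_smul_comp_sub ha b y).fderiv]
    simp only [Function.comp_apply]
    rw [ih]
    exact (ContinuousLinearEquiv.integral_comp_comm (𝕜 := ℝ) (μ := volume)
      (E := Rn n [×k]→L[ℝ] Rn n →L[ℝ] F) (F := Rn n [×k.succ]→L[ℝ] F)
      (continuousMultilinearCurryRightEquiv' ℝ k (Rn n) F).symm.toContinuousLinearEquiv
      (fun x => a x • iteratedFDeriv ℝ k (SchwartzMap.fderivCLM ℂ (Rn n) F b) (y - x))).symm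

end Convolution

/-! ### Tempered distributions and vector-valued integrals of translates -/

section WeightedDeriv

variable {n : ℕ}

/-- The space of bounded continuous functions in which `y ↦ ‖y‖ ^ i.1 • D^{i.2} φ y` lives. -/
def DerivSpace (n : ℕ) (i : ℕ × ℕ) : Type :=
  BoundedContinuousFunction (Rn n) (ContinuousMultilinearMap ℝ (fun _ : Fin i.2 => Rn n) ℂ)

noncomputable instance (i : ℕ × ℕ) : NormedAddCommGroup (DerivSpace n i) :=
  inferInstanceAs (NormedAddCommGroup (BoundedContinuousFunction (Rn n)
    (ContinuousMultilinearMap ℝ (fun _ : Fin i.2 => Rn n) ℂ)))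

noncomputable instance (i : ℕ × ℕ) : NormedSpace ℂ (DerivSpace n i) :=
  inferInstanceAs (NormedSpace ℂ (BoundedContinuousFunction (Rn n)
    (ContinuousMultilinearMap ℝ (fun _ : Fin i.2 => Rn n) ℂ)))

instance (i : ℕ × ℕ) : CompleteSpace (DerivSpace n i) :=
  inferInstanceAs (CompleteSpace (BoundedContinuousFunction (Rn n)
    (ContinuousMultilinearMap ℝ (fun _ : Fin i.2 => Rn n) ℂ)))

/-- The value of an element of `DerivSpace n i` at a point. -/
noncomputable def DerivSpace.val {i : ℕ × ℕ} (B : DerivSpace n i) (y : Rn n) :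
    ContinuousMultilinearMap ℝ (fun _ : Fin i.2 => Rn n) ℂ :=
  BoundedContinuousFunction.instFunLike.coe B y

theorem DerivSpace.norm_val_le {i : ℕ × ℕ} (B : DerivSpace n i) (y : Rn n) : ‖B.val y‖ ≤ ‖B‖ :=
  BoundedContinuousFunction.norm_coe_le_norm _ y

theorem DerivSpace.norm_le {i : ℕ × ℕ} {B : DerivSpace n i} {C : ℝ} (hC : 0 ≤ C)
    (h : ∀ y, ‖B.val y‖ ≤ C) : ‖B‖ ≤ C :=
  (BoundedContinuousFunction.norm_le hC).2 h

theorem DerivSpace.ext {i : ℕ × ℕ} {B B' : DerivSpace n i} (h : ∀ y, B.val y = B'.val y) :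
    B = B' :=
  BoundedContinuousFunction.ext h

/-- Evaluation at a point and at a tuple of vectors. -/
noncomputable def DerivSpace.eval {i : ℕ × ℕ} (y : Rn n) (v : Fin i.2 → Rn n) :
    DerivSpace n i →L[ℂ] ℂ :=
  LinearMap.mkContinuous
    { toFun := fun B => B.val y v
      map_add' := fun _ _ => rfl
      map_smul' := fun _ _ => rfl } (∏ j, ‖v j‖) fun B =>
      ((B.val y).le_opNorm v).trans (by
        rw [mul_comm]
        exact mul_le_mul_of_nonneg_left (B.norm_val_le y)
          (Finset.prod_nonneg fun _ _ => norm_nonneg _))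

theorem DerivSpace.eval_apply {i : ℕ × ℕ} (y : Rn n) (v : Fin i.2 → Rn n) (B : DerivSpace n i) :
    DerivSpace.eval y v B = B.val y v := rfl

theorem continuous_pow_smul_iteratedFDeriv (i : ℕ × ℕ) (φ : 𝓢(Rn n, ℂ)) :
    Continuous fun y => ‖y‖ ^ i.1 • iteratedFDeriv ℝ i.2 φ y :=
  (continuous_norm.pow _).smul ((φ.smooth ⊤).continuous_iteratedFDeriv (by exact_mod_cast le_top))

/-- The weighted derivative `y ↦ ‖y‖ ^ i.1 • D^{i.2} φ y`. -/
noncomputable def weightedDeriv (i : ℕ × ℕ) (φ : 𝓢(Rn n, ℂ)) : DerivSpace n i :=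
  BoundedContinuousFunction.ofNormedAddCommGroup
    (fun y => ‖y‖ ^ i.1 • iteratedFDeriv ℝ i.2 φ y)
    (continuous_pow_smul_iteratedFDeriv i φ) (SchwartzMap.seminorm ℂ i.1 i.2 φ)
    (fun y => by
      rw [norm_smul, norm_pow, norm_norm]
      exact φ.le_seminorm ℂ i.1 i.2 y)

theorem weightedDeriv_val (i : ℕ × ℕ) (φ : 𝓢(Rn n, ℂ)) (y : Rn n) :
    (weightedDeriv i φ).val y = ‖y‖ ^ i.1 • iteratedFDeriv ℝ i.2 φ y := rfl

theorem norm_weightedDeriv (i : ℕ × ℕ) (φ : 𝓢(Rn n, ℂ)) :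
    ‖weightedDeriv i φ‖ = SchwartzMap.seminorm ℂ i.1 i.2 φ := by
  refine le_antisymm ?_ ?_
  · refine DerivSpace.norm_le (by positivity) fun y => ?_
    rw [weightedDeriv_val, norm_smul, norm_pow, norm_norm]
    exact φ.le_seminorm ℂ i.1 i.2 y
  · refine SchwartzMap.seminorm_le_bound ℂ i.1 i.2 φ (norm_nonneg (weightedDeriv i φ)) fun y => ?_
    have := (weightedDeriv i φ).norm_val_le y
    rwa [weightedDeriv_val, norm_smul, norm_pow, norm_norm] at this

/-- The weighted derivative as a continuous linear map. -/
noncomputable def weightedDerivCLM (n : ℕ) (i : ℕ × ℕ) : 𝓢(Rn n, ℂ) →L[ℂ] DerivSpace n i :=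
  SchwartzMap.mkCLMtoNormedSpace (σ := RingHom.id ℂ) (weightedDeriv i)
    (fun φ ψ => DerivSpace.ext fun y => by
      have : iteratedFDeriv ℝ i.2 (φ + ψ : 𝓢(Rn n, ℂ)) y =
          iteratedFDeriv ℝ i.2 φ y + iteratedFDeriv ℝ i.2 ψ y :=
        iteratedFDeriv_add_apply (φ.contDiffAt _) (ψ.contDiffAt _)
      exact (congrArg (‖y‖ ^ i.1 • ·) this).trans (smul_add _ _ _))
    (fun c φ => DerivSpace.ext fun y => by
      have : iteratedFDeriv ℝ i.2 (c • φ : 𝓢(Rn n, ℂ)) y = c • iteratedFDeriv ℝ i.2 φ y :=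
        iteratedFDeriv_const_smul_apply (φ.contDiffAt _)
      exact (congrArg (‖y‖ ^ i.1 • ·) this).trans (smul_comm _ _ _))
    ⟨{i}, 1, zero_le_one, fun φ => by
      rw [one_mul, Finset.sup_singleton]
      exact (norm_weightedDeriv i φ).le⟩

theorem weightedDerivCLM_apply (i : ℕ × ℕ) (φ : 𝓢(Rn n, ℂ)) :
    weightedDerivCLM n i φ = weightedDeriv i φ := rfl

theorem integrable_smul_translate {V : Type*} [NormedAddCommGroup V] [NormedSpace ℂ V]
    (L : 𝓢(Rn n, ℂ) →L[ℂ] V) (a b : 𝓢(Rn n, ℂ)) :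
    Integrable fun x => a x • L (translate x b) := by
  obtain ⟨s, C, -, hC⟩ := Seminorm.bound_of_continuous (schwartz_withSeminorms ℂ (Rn n) ℂ)
    ((normSeminorm ℂ V).comp L.toLinearMap) (continuous_norm.comp L.continuous)
  obtain ⟨D, N, hD0, hD⟩ := exists_seminorm_translate_le b s
  refine ((integrable_one_add_norm_pow_mul a N).const_mul (C * D)).mono' ?_
    (Filter.Eventually.of_forall fun x => ?_)
  · exact (a.continuous.smul (L.continuous.comp (continuous_translate b))).aestronglyMeasurable
  · have h1 : ‖L (translate x b)‖ ≤ C * (D * (1 + ‖x‖) ^ N) :=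
      (hC (translate x b)).trans (mul_le_mul_of_nonneg_left (hD x) C.2)
    rw [norm_smul]
    calc _ ≤ ‖a x‖ * (C * (D * (1 + ‖x‖) ^ N)) := by gcongr
      _ = _ := by ring

theorem integrable_smul_iteratedFDeriv_comp_sub (a b : 𝓢(Rn n, ℂ)) (k : ℕ) (y : Rn n) :
    Integrable fun x => a x • iteratedFDeriv ℝ k b (y - x) := by
  refine a.integrable.smul_bdd (C := SchwartzMap.seminorm ℝ 0 k b) ?_ ?_
  · exact (((b.smooth ⊤).continuous_iteratedFDeriv (by exact_mod_cast le_top)).comp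
      (by fun_prop)).aestronglyMeasurable
  · exact Filter.Eventually.of_forall fun x => b.norm_iteratedFDeriv_le_seminorm ℝ k _

/-- Evaluation at a point and a tuple of vectors is continuous, so it passes under the Bochner
integral. The identity serves twice: it gives the decay of the convolution, and it identifies the
integral when a distribution is applied. -/
theorem integral_smul_weightedDerivCLM_val (a b : 𝓢(Rn n, ℂ)) (i : ℕ × ℕ) (y : Rn n) :
    (∫ x, a x • weightedDerivCLM n i (translate x b)).val y =
      ‖y‖ ^ i.1 • iteratedFDeriv ℝ i.2 (fun y => ∫ x, a x • b (y - x)) y := by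
  ext v
  rw [iteratedFDeriv_integral_smul_comp_sub a.integrable, ← DerivSpace.eval_apply,
    ← ContinuousLinearMap.integral_comp_comm _
      (integrable_smul_translate (weightedDerivCLM n i) a b), smul_apply,
    ContinuousMultilinearMap.integral_apply
      (integrable_smul_iteratedFDeriv_comp_sub a b i.2 y), ← integral_smul]
  refine integral_congr_ae (Filter.Eventually.of_forall fun x => ?_)
  simp only [map_smul, DerivSpace.eval_apply, weightedDerivCLM_apply, weightedDeriv_val,
    iteratedFDeriv_translate, smul_apply]
  rw [smul_comm]

/-- The convolution `y ↦ ∫ a(x) b(y - x) dx` of two Schwartz functions. -/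
noncomputable def schwartzConv (a b : 𝓢(Rn n, ℂ)) : 𝓢(Rn n, ℂ) where
  toFun y := ∫ x, a x • b (y - x)
  smooth' := contDiff_infty.2 fun k => contDiff_integral_smul_comp_sub a.integrable k b
  decay' k m := by
    refine ⟨‖∫ x, a x • weightedDerivCLM n (k, m) (translate x b)‖, fun y => ?_⟩
    have h := (∫ x, a x • weightedDerivCLM n (k, m) (translate x b)).norm_val_le y
    rwa [integral_smul_weightedDerivCLM_val, norm_smul, norm_pow, norm_norm] at h

theorem schwartzConv_apply (a b : 𝓢(Rn n, ℂ)) (y : Rn n) :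
    schwartzConv a b y = ∫ x, a x • b (y - x) := rfl

theorem schwartzConv_comm (a b : 𝓢(Rn n, ℂ)) : schwartzConv a b = schwartzConv b a := by
  ext y
  rw [schwartzConv_apply, schwartzConv_apply,
    ← integral_sub_left_eq_self (fun x => a x • b (y - x)) volume y]
  simp [mul_comm]

/-- Hahn–Banach, applied to `T` carried over to the range of `ι`. The Schwartz space is not normed;
after this factorization the interchange with integrals takes place in a Banach space. -/
theorem exists_extension_of_norm_le {V : Type*} [NormedAddCommGroup V] [NormedSpace ℂ V]
    (T : 𝓢'(Rn n, ℂ)) (ι : 𝓢(Rn n, ℂ) →L[ℂ] V) (hinj : Function.Injective ι) (C : ℝ)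
    (hC : ∀ φ, ‖T φ‖ ≤ C * ‖ι φ‖) : ∃ L : V →L[ℂ] ℂ, ∀ φ, T φ = L (ι φ) := by
  set e := LinearEquiv.ofInjective ι.toLinearMap hinj
  obtain ⟨L, hL, -⟩ := exists_extension_norm_eq ι.toLinearMap.range
    (LinearMap.mkContinuous (T.toLinearMap ∘ₗ e.symm.toLinearMap) C fun v => by
      have h1 := hC (e.symm v)
      have h2 : ι (e.symm v) = v := congrArg Subtype.val (e.apply_symm_apply v)
      rw [h2] at h1
      exact h1)
  refine ⟨L, fun φ => ?_⟩
  have h := hL (e φ)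
  have h2 : T (e.symm (e φ)) = T φ := by rw [e.symm_apply_apply]
  exact h2.symm.trans h.symm

/-- The family of the weighted derivatives with indices in `s`. -/
noncomputable def weightedDerivPi (n : ℕ) (s : Finset (ℕ × ℕ)) :
    𝓢(Rn n, ℂ) →L[ℂ] ((i : s) → DerivSpace n i) :=
  ContinuousLinearMap.pi fun i : s => weightedDerivCLM n i

/-- A tempered distribution factors through finitely many weighted derivatives. -/
theorem exists_extension_weightedDerivPi (T : 𝓢'(Rn n, ℂ)) :
    ∃ (s : Finset (ℕ × ℕ)) (L : ((i : s) → DerivSpace n i) →L[ℂ] ℂ),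
      ∀ φ, T φ = L (weightedDerivPi n s φ) := by
  obtain ⟨s₀, C, hC0, hC⟩ := exists_norm_le_sup_seminorm T
  -- The index `(0, 0)` records `φ` itself and makes the map injective.
  set s := insert (0, 0) s₀
  have hinj : Function.Injective (weightedDerivPi n s) := fun φ ψ h => by
    ext y
    have h1 : weightedDeriv (0, 0) φ = weightedDeriv (0, 0) ψ :=
      congrFun h ⟨(0, 0), Finset.mem_insert_self _ _⟩
    have h2 := congrArg (fun B => B.val y (fun _ => 0)) h1
    simpa [weightedDeriv_val] using h2
  obtain ⟨L, hL⟩ := exists_extension_of_norm_le T (weightedDerivPi n s) hinj C fun φ => by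
    refine (hC φ).trans (mul_le_mul_of_nonneg_left ?_ hC0)
    refine Seminorm.finset_sup_apply_le (norm_nonneg _) fun i hi => ?_
    refine (norm_weightedDeriv i φ).ge.trans ?_
    exact norm_le_pi_norm (weightedDerivPi n s φ) ⟨i, Finset.mem_insert_of_mem hi⟩
  exact ⟨s, L, hL⟩

/-- A tempered distribution may be applied under the integral sign of a convolution. -/
theorem apply_schwartzConv (T : 𝓢'(Rn n, ℂ)) (a b : 𝓢(Rn n, ℂ)) :
    T (schwartzConv a b) = ∫ x, a x * T (translate x b) := by
  obtain ⟨s, L, hL⟩ := exists_extension_weightedDerivPi T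
  have hint := integrable_smul_translate (weightedDerivPi n s) a b
  have key : (∫ x, a x • weightedDerivPi n s (translate x b)) =
      weightedDerivPi n s (schwartzConv a b) := by
    ext1 i
    have h1 : (∫ x, a x • weightedDerivPi n s (translate x b)) i =
        ∫ x, (a x • weightedDerivPi n s (translate x b)) i :=
      eval_integral (f := fun x => a x • weightedDerivPi n s (translate x b))
        (fun i : s => integrable_smul_translate (weightedDerivCLM n i) a b) i
    rw [h1]
    exact DerivSpace.ext fun y => integral_smul_weightedDerivCLM_val a b i y
  rw [hL, ← key, ← L.integral_comp_comm hint]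
  refine integral_congr_ae (Filter.Eventually.of_forall fun x => ?_)
  simp only [map_smul, smul_eq_mul]
  rw [hL]

end WeightedDeriv

/-! ### From Hajłasz gradients to the grand maximal function -/

section Basic

variable {n : ℕ}

theorem partialDeriv_zero (φ : 𝓢(Rn n, ℂ)) : partialDeriv 0 φ = φ := by
  simp [partialDeriv]

theorem integral_eq_zero_of_mem_testClass {ℓ : ℕ} {m : ℝ} {φ : 𝓢(Rn n, ℂ)}
    (hφ : φ ∈ testClass n 0 ℓ m) : ∫ x, φ x = 0 := by
  simpa using hφ.1 0 (by simp)

theorem enorm_le_of_mem_testClass {ℓ : ℕ} {m : ℝ} {φ : 𝓢(Rn n, ℂ)}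
    (hφ : φ ∈ testClass n 0 ℓ m) (x : Rn n) :
    ‖φ x‖ₑ ≤ ENNReal.ofReal ((1 + ‖x‖) ^ (-m)) := by
  have h1 : 0 < (1 + ‖x‖) ^ m := by positivity
  have h : ENNReal.ofReal ((1 + ‖x‖) ^ m) * ‖partialDeriv 0 φ x‖ₑ ≤ 1 := by
    refine le_trans ?_ hφ.2
    refine le_iSup_of_le 0 (le_iSup_of_le (by simp) ?_)
    exact le_iSup (fun x => ENNReal.ofReal ((1 + ‖x‖) ^ m) * ‖partialDeriv 0 φ x‖ₑ) x
  rw [partialDeriv_zero, mul_comm, ← ENNReal.le_div_iff_mul_le (Or.inl (by simpa using h1))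
    (Or.inl ENNReal.ofReal_ne_top), one_div, ← ENNReal.ofReal_inv_of_pos h1] at h
  rwa [Real.rpow_neg (by positivity)]

theorem eLpNorm_ofReal_eq {ε : Type*} [ENorm ε] {p : ℝ} (hp : 0 < p) (f : Rn n → ε) :
    eLpNorm f (ENNReal.ofReal p) volume = (∫⁻ x, ‖f x‖ₑ ^ p) ^ (1 / p) := by
  rw [eLpNorm_eq_lintegral_rpow_enorm_toReal (by simpa using hp) ENNReal.ofReal_ne_top,
    ENNReal.toReal_ofReal hp.le]

theorem grandTLNorm_eq {p : ℝ} (hp : 0 < p) (A : Set 𝓢(Rn n, ℂ)) (s : ℝ) (T : 𝓢'(Rn n, ℂ)) :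
    grandTLNorm A s p T = (∫⁻ x, grandMaximal A s T x ^ p) ^ (1 / p) := by
  rw [grandTLNorm, eLpNorm_ofReal_eq hp]
  simp

theorem eLpNorm_ofReal_eq_of_nonneg {p : ℝ} (hp : 0 < p) {g : Rn n → ℝ} (hg : ∀ x, 0 ≤ g x) :
    eLpNorm g (ENNReal.ofReal p) volume = (∫⁻ x, ENNReal.ofReal (g x) ^ p) ^ (1 / p) := by
  rw [eLpNorm_ofReal_eq hp]
  simp_rw [Real.enorm_of_nonneg (hg _)]

theorem IsHajlaszGradient.exists_isGradientOff {s : ℝ} {f : Rn n → ℂ} {g : Rn n → ℝ}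
    (hg : IsHajlaszGradient s f g) : ∃ E, IsGradientOff s f (fun x => ENNReal.ofReal (g x)) E := by
  obtain ⟨hm, h0, E, hE, h⟩ := hg
  refine ⟨E, hm.ennreal_ofReal, hE, fun _ _ => ENNReal.ofReal_ne_top, fun x hx y hy => ?_⟩
  rw [← ENNReal.ofReal_add (h0 x) (h0 y), ← ENNReal.ofReal_mul (by positivity),
    ← ofReal_norm]
  exact ENNReal.ofReal_le_ofReal (h x hx y hy)

/-- For `r > 0`, `n * (1 / r - 1) < s` is equivalent to `n / (n + s) < r`, so the hypothesis on `p`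
leaves room for `r` below both `p` and 1. -/
theorem exists_order {s p : ℝ} (hs : 0 < s) (hp : (n : ℝ) / (n + s) < p) :
    ∃ r : ℝ, 0 < r ∧ r ≤ 1 ∧ r < p ∧ n * (1 / r - 1) < s := by
  have hn : (0 : ℝ) ≤ n := Nat.cast_nonneg n
  have hns : (0 : ℝ) < n + s := by linarith
  have h1 : (n : ℝ) / (n + s) < 1 := (div_lt_one hns).2 (by linarith)
  obtain ⟨r, hr, hr'⟩ := exists_between (lt_min hp h1)
  have hr0 : 0 < r := lt_of_le_of_lt (by positivity) hr
  refine ⟨r, hr0, (hr'.trans_le (min_le_right _ _)).le, hr'.trans_le (min_le_left _ _), ?_⟩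
  rw [div_lt_iff₀ hns, ← div_lt_iff₀' hr0] at hr
  rw [mul_sub, mul_one_div, mul_one]
  linarith

/-- The condition on `p` is open in the smoothness: it reads `n / p - n < s`. The gap `s - s'` later
becomes the decay `2 ^ (-k * (s - s'))`. -/
theorem exists_smaller_smoothness {s p : ℝ} (hs : 0 < s) (hp : (n : ℝ) / (n + s) < p) :
    ∃ s' : ℝ, 0 < s' ∧ s' < s ∧ (n : ℝ) / (n + s') < p := by
  have hn : (0 : ℝ) ≤ n := Nat.cast_nonneg n
  have hns : (0 : ℝ) < n + s := by linarith
  have hp0 : 0 < p := lt_of_le_of_lt (by positivity) hp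
  rw [div_lt_iff₀ hns, ← div_lt_iff₀' hp0] at hp
  obtain ⟨s', h1, h2⟩ := exists_between (max_lt hs (show (n : ℝ) / p - n < s by linarith))
  have hs' : 0 < s' := (le_max_left _ _).trans_lt h1
  have h3 := (le_max_right _ _).trans_lt h1
  refine ⟨s', hs', h2, ?_⟩
  rw [div_lt_iff₀ (by linarith), ← div_lt_iff₀' hp0]
  linarith

end Basic

/-! ### Functions with a Hajłasz gradient as tempered distributions -/

section Representation

variable {n : ℕ}

theorem rpow_neg_le_mul_rpow_neg (x y : Rn n) {q : ℝ} (hq : 0 ≤ q) :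
    (1 + ‖y‖) ^ (-q) ≤ (1 + ‖x‖) ^ q * (1 + dist y x) ^ (-q) := by
  have h1 : 1 + dist y x ≤ (1 + ‖x‖) * (1 + ‖y‖) := by
    have := dist_le_norm_add_norm y x
    nlinarith [mul_nonneg (norm_nonneg x) (norm_nonneg y)]
  have h2 : (1 + dist y x) ^ q ≤ (1 + ‖x‖) ^ q * (1 + ‖y‖) ^ q := by
    rw [← Real.mul_rpow (by positivity) (by positivity)]
    gcongr
  rw [Real.rpow_neg (by positivity), Real.rpow_neg (by positivity), ← div_eq_mul_inv,
    le_div_iff₀ (by positivity), inv_mul_le_iff₀ (by positivity)]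
  linarith

/-- The weighted mean oscillation of `f` from its value at a point. -/
theorem exists_lintegral_enorm_sub_mul_one_add_norm_rpow_le {s r q : ℝ} (hs : 0 < s) (hs1 : s ≤ 1)
    (hr : 0 < r) (hr1 : r ≤ 1) (hrs : n * (1 / r - 1) < s) (hq : n + s < q) :
    ∃ C : ℝ≥0, ∀ (f : Rn n → ℂ) (G : Rn n → ℝ≥0∞) (E : Set (Rn n)), IsGradientOff s f G E →
      AEMeasurable f volume → ∀ x ∉ E,
        ∫⁻ y, ‖f y - f x‖ₑ * ENNReal.ofReal ((1 + ‖y‖) ^ (-q)) ≤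
          ENNReal.ofReal ((1 + ‖x‖) ^ q) * (C * (maximalPow r G x + G x)) := by
  obtain ⟨C, hC⟩ := exists_lintegral_enorm_sub_mul_rpow_le (n := n) hs hs1 hr hr1 hrs hq
  have hq0 : 0 < q := by linarith [Nat.cast_nonneg (α := ℝ) n]
  refine ⟨C, fun f G E hG hf x hx => ?_⟩
  have h := hC f G E hG hf x x 0 hx (mem_closedBall_self (by positivity))
  simp only [zpow_zero, div_one, Int.cast_zero, zero_mul, ENNReal.rpow_zero, mul_one] at h
  calc _ ≤ ∫⁻ y, ENNReal.ofReal ((1 + ‖x‖) ^ q) *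
        (‖f y - f x‖ₑ * ENNReal.ofReal ((1 + dist y x) ^ (-q))) := by
        refine lintegral_mono fun y => ?_
        rw [mul_left_comm, ← ENNReal.ofReal_mul (by positivity)]
        gcongr
        exact rpow_neg_le_mul_rpow_neg x y hq0.le
    _ = ENNReal.ofReal ((1 + ‖x‖) ^ q) *
        ∫⁻ y, ‖f y - f x‖ₑ * ENNReal.ofReal ((1 + dist y x) ^ (-q)) :=
        lintegral_const_mul' _ _ ENNReal.ofReal_ne_top
    _ ≤ _ := mul_le_mul_right h _

/-- A Schwartz function is dominated by a negative power of `1 + ‖y‖`, with control by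
seminorms. -/
theorem norm_le_sup_seminorm_mul_rpow (N : ℕ) (ψ : 𝓢(Rn n, ℂ)) (y : Rn n) :
    ‖ψ y‖ ≤ 2 ^ N * ((Finset.Iic (N, 0)).sup (schwartzSeminormFamily ℂ (Rn n) ℂ)) ψ *
      (1 + ‖y‖) ^ (-(N : ℝ)) := by
  have h := SchwartzMap.one_add_le_sup_seminorm_apply (𝕜 := ℂ) (m := (N, 0)) le_rfl le_rfl ψ y
  rw [norm_iteratedFDeriv_zero] at h
  rw [Real.rpow_neg (by positivity), Real.rpow_natCast, ← div_eq_mul_inv,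
    le_div_iff₀ (by positivity), mul_comm]
  exact h

theorem exists_represents_of_integrable {f : Rn n → ℂ} (hf : AEStronglyMeasurable f volume)
    (N : ℕ) (hint : Integrable fun y => ‖f y‖ * (1 + ‖y‖) ^ (-(N : ℝ))) :
    ∃ T : 𝓢'(Rn n, ℂ), Represents f T := by
  have hbound : ∀ (ψ : 𝓢(Rn n, ℂ)) y, ‖f y * ψ y‖ ≤
      2 ^ N * ((Finset.Iic (N, 0)).sup (schwartzSeminormFamily ℂ (Rn n) ℂ)) ψ *
        (‖f y‖ * (1 + ‖y‖) ^ (-(N : ℝ))) := fun ψ y => by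
    rw [norm_mul]
    calc _ ≤ ‖f y‖ * _ :=
          mul_le_mul_of_nonneg_left (norm_le_sup_seminorm_mul_rpow N ψ y) (norm_nonneg _)
      _ = _ := by ring
  have hfψ : ∀ ψ : 𝓢(Rn n, ℂ), Integrable fun y => f y * ψ y := fun ψ =>
    (hint.const_mul _).mono' (hf.mul ψ.continuous.aestronglyMeasurable)
      (Filter.Eventually.of_forall (hbound ψ))
  have hloc : LocallyIntegrable f volume := by
    -- Multiplying by the continuous inverse of the weight recovers the local integrability of `f`.
    have h1 := LocallyIntegrable.continuous_smul (g := fun y : Rn n => (1 + ‖y‖) ^ N)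
      (by fun_prop) hint.locallyIntegrable
    refine h1.mono hf (Filter.Eventually.of_forall fun y => le_of_eq ?_)
    rw [Real.rpow_neg (by positivity), Real.rpow_natCast, norm_smul, norm_mul, norm_inv, norm_norm]
    have : ‖(1 + ‖y‖) ^ N‖ ≠ 0 := by
      rw [norm_ne_zero_iff]; positivity
    field_simp
  let A : 𝓢(Rn n, ℂ) →L[ℂ] ℂ := SchwartzMap.mkCLMtoNormedSpace (σ := RingHom.id ℂ)
    (fun ψ => ∫ y, f y * ψ y)
    (fun φ ψ => by
      rw [← integral_add (hfψ φ) (hfψ ψ)]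
      simp [mul_add])
    (fun c φ => by
      rw [RingHom.id_apply, ← integral_smul]
      simp [mul_left_comm])
    ⟨Finset.Iic (N, 0), 2 ^ N * ∫ y, ‖f y‖ * (1 + ‖y‖) ^ (-(N : ℝ)), by positivity, fun ψ => by
      calc _ ≤ ∫ y, 2 ^ N * ((Finset.Iic (N, 0)).sup (schwartzSeminormFamily ℂ (Rn n) ℂ)) ψ *
            (‖f y‖ * (1 + ‖y‖) ^ (-(N : ℝ))) :=
            norm_integral_le_of_norm_le (hint.const_mul _)
              (Filter.Eventually.of_forall (hbound ψ))
        _ = _ := by rw [integral_const_mul]; ring⟩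
  exact ⟨A.toPointwiseConvergenceCLM _ _ _ _, hloc, fun ψ => ⟨hfψ ψ, rfl⟩⟩

/-- Provides a base point at which the right side of the weighted oscillation estimate is finite. -/
theorem IsGradientOff.exists_notMem_maximalPow_lt_top {s r p : ℝ} (hr : 0 < r) (hrp : r < p)
    {f : Rn n → ℂ} {G : Rn n → ℝ≥0∞} {E : Set (Rn n)} (hG : IsGradientOff s f G E)
    (hGp : ∫⁻ x, G x ^ p ≠ ∞) : ∃ x ∉ E, maximalPow r G x < ∞ := by
  obtain ⟨C, hC⟩ := exists_lintegral_maximalPow_rpow_le n hr hrp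
  have hmeas : Measurable (maximalPow r G) :=
    (measurable_dyadicMaximal (hG.measurable.pow_const r)).pow_const _
  have h1 : ∀ᵐ x, maximalPow r G x ^ p < ∞ := ae_lt_top (hmeas.pow_const p)
    ((hC G hG.measurable).trans_lt (ENNReal.mul_lt_top ENNReal.coe_lt_top hGp.lt_top)).ne
  obtain ⟨x, hx, hxE⟩ := (h1.and (measure_eq_zero_iff_ae_notMem.1 hG.null)).exists
  exact ⟨x, hxE, (ENNReal.rpow_lt_top_iff_of_pos (hr.trans hrp)).1 hx⟩

/-- A function with a Hajłasz gradient in `L^p` represents a tempered distribution. -/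
theorem IsGradientOff.exists_represents {s p : ℝ} (hs : 0 < s) (hs1 : s ≤ 1)
    (hp : (n : ℝ) / (n + s) < p) {f : Rn n → ℂ} {G : Rn n → ℝ≥0∞} {E : Set (Rn n)}
    (hG : IsGradientOff s f G E) (hf : AEStronglyMeasurable f volume)
    (hGp : ∫⁻ x, G x ^ p ≠ ∞) : ∃ T : 𝓢'(Rn n, ℂ), Represents f T := by
  obtain ⟨r, hr, hr1, hrp, hrs⟩ := exists_order hs hp
  obtain ⟨x, hx, hxM⟩ := hG.exists_notMem_maximalPow_lt_top hr hrp hGp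
  -- As `s ≤ 1`, the integer `n + 2` exceeds `n + s`; it also exceeds `n`, so the weight itself is
  -- integrable.
  have hq : (n : ℝ) + s < ((n + 2 : ℕ) : ℝ) := by push_cast; linarith
  obtain ⟨C, hC⟩ := exists_lintegral_enorm_sub_mul_one_add_norm_rpow_le (n := n) hs hs1 hr hr1
    hrs hq
  have h := hC f G E hG hf.aemeasurable x hx
  refine exists_represents_of_integrable hf (n + 2) ?_
  have hw : Integrable fun y : Rn n => (1 + ‖y‖) ^ (-((n + 2 : ℕ) : ℝ)) :=
    integrable_one_add_norm (by simp)
  have hsub : Integrable fun y => ‖f y - f x‖ * (1 + ‖y‖) ^ (-((n + 2 : ℕ) : ℝ)) := by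
    refine ⟨(hf.sub aestronglyMeasurable_const).norm.mul hw.aestronglyMeasurable, ?_⟩
    refine (lintegral_mono fun y => ?_).trans_lt (h.trans_lt ?_)
    · rw [enorm_mul, enorm_norm, Real.enorm_of_nonneg (by positivity)]
    · have := hG.ne_top x hx
      have := hxM.ne
      finiteness
  refine (hsub.add (hw.const_mul ‖f x‖)).mono'
    (hf.norm.mul hw.aestronglyMeasurable) (Filter.Eventually.of_forall fun y => ?_)
  rw [norm_mul, norm_norm, Real.norm_of_nonneg (by positivity), Pi.add_apply, ← add_mul]
  gcongr
  have := norm_add_le (f y - f x) (f x)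
  rwa [sub_add_cancel] at this

end Representation

/-! ### The grand maximal function bounded by the gradient -/

section GrandMaximal

variable {n : ℕ}

theorem enorm_reflectTranslate_dilate_le {ℓ : ℕ} {m : ℝ} {φ : 𝓢(Rn n, ℂ)}
    (hφ : φ ∈ testClass n 0 ℓ m) (k : ℤ) (x y : Rn n) (hk : (0 : ℝ) < 2 ^ k) :
    ‖reflectTranslate x (dilate ((2 : ℝ) ^ k) hk φ) y‖ₑ ≤
      2 ^ (-((k : ℝ) * n)) * ENNReal.ofReal ((1 + dist y x / 2 ^ k) ^ (-m)) := by
  rw [reflectTranslate_apply, dilate_apply, enorm_smul]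
  refine mul_le_mul' (le_of_eq ?_) ((enorm_le_of_mem_testClass hφ _).trans (le_of_eq ?_))
  · rw [Real.enorm_of_nonneg (by positivity), ENNReal.ofReal_inv_of_pos (by positivity),
      ENNReal.rpow_neg, ← ofReal_two_zpow_rpow, Real.rpow_natCast]
  · rw [norm_smul, norm_inv, Real.norm_of_nonneg hk.le, ← dist_eq_norm, dist_comm,
      inv_mul_eq_div]

theorem integral_reflectTranslate_dilate (φ : 𝓢(Rn n, ℂ)) {t : ℝ} (ht : 0 < t) (x : Rn n) :
    ∫ y, reflectTranslate x (dilate t ht φ) y = ∫ y, φ y := by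
  simp_rw [reflectTranslate_apply]
  rw [integral_sub_left_eq_self (fun y => dilate t ht φ y)]
  simp_rw [dilate_apply]
  rw [integral_smul, Measure.integral_comp_inv_smul_of_nonneg _ _ ht.le, finrank_euclideanSpace,
    Fintype.card_fin, smul_smul, inv_mul_cancel₀ (by positivity), one_smul]

/-- Since `φ` has mean zero, `f` may be replaced by `f - f z`, where `z` is a point of the ball of
radius `2 ^ (-k)` about `x` with `G z ≤ maximalPow r G x`. Only the size of `φ` enters, not that of
its derivatives. Taking `z` in place of `x` makes the bound valid at every `x`, also on `E`. -/
theorem exists_grandMaximal_le {s r m : ℝ} (ℓ : ℕ) (hs : 0 < s) (hs1 : s ≤ 1)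
    (hr : 0 < r) (hr1 : r ≤ 1) (hrs : n * (1 / r - 1) < s) (hm : (n : ℝ) + 1 < m) :
    ∃ C : ℝ≥0, ∀ (f : Rn n → ℂ) (T : 𝓢'(Rn n, ℂ)) (G : Rn n → ℝ≥0∞) (E : Set (Rn n)),
      IsGradientOff s f G E → Represents f T →
        ∀ x, grandMaximal (testClass n 0 ℓ m) s T x ≤ C * maximalPow r G x := by
  obtain ⟨C, hC⟩ := exists_lintegral_enorm_sub_mul_rpow_le (n := n) (q := m) hs hs1 hr hr1 hrs
    (by linarith)
  refine ⟨C * 2, fun f T G E hG hT x => iSup_le fun k => ?_⟩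
  have hfm : AEMeasurable f volume := hT.1.aestronglyMeasurable.aemeasurable
  have hk : (0 : ℝ) < 2 ^ (-k) := by positivity
  obtain ⟨z, hz, hzx, hGz⟩ := hG.exists_le_average hr x hk
  have hGz' : G z ≤ maximalPow r G x := by
    refine hGz.trans (ENNReal.rpow_le_rpow ?_ (by positivity))
    exact le_iSup (fun j : ℤ => ⨍⁻ y in closedBall x ((2 : ℝ) ^ j), G y ^ r ∂volume) (-k)
  have key : ∀ φ ∈ testClass n 0 ℓ m, ‖conv (dilate ((2 : ℝ) ^ (-k)) hk φ) T x‖ₑ ≤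
      2 ^ (-((k : ℝ) * s)) * (C * (2 * maximalPow r G x)) := by
    intro φ hφ
    set χ := reflectTranslate x (dilate ((2 : ℝ) ^ (-k)) hk φ) with hχ
    have h0 : ∫ y, χ y = 0 := by
      rw [hχ, integral_reflectTranslate_dilate, integral_eq_zero_of_mem_testClass hφ]
    have e : conv (dilate ((2 : ℝ) ^ (-k)) hk φ) T x = ∫ y, (f y - f z) * χ y := by
      have h1 : ∫ y, f z * χ y = 0 := by rw [integral_const_mul, h0, mul_zero]
      simp_rw [sub_mul]
      rw [integral_sub (hT.2 χ).1 (χ.integrable.const_mul _), h1, sub_zero]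
      exact (hT.2 χ).2
    calc _ = ‖∫ y, (f y - f z) * χ y‖ₑ := by rw [e]
      _ ≤ ∫⁻ y, ‖(f y - f z) * χ y‖ₑ := enorm_integral_le_lintegral_enorm _
      _ ≤ ∫⁻ y, 2 ^ ((k : ℝ) * n) * (‖f y - f z‖ₑ *
            ENNReal.ofReal ((1 + dist y x / 2 ^ (-k)) ^ (-m))) := by
          refine lintegral_mono fun y => ?_
          rw [enorm_mul, mul_left_comm]
          refine mul_le_mul_right ((enorm_reflectTranslate_dilate_le hφ (-k) x y hk).trans
            (le_of_eq ?_)) _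
          simp
      _ = 2 ^ ((k : ℝ) * n) * ∫⁻ y, ‖f y - f z‖ₑ *
            ENNReal.ofReal ((1 + dist y x / 2 ^ (-k)) ^ (-m)) :=
          lintegral_const_mul' _ _ (two_rpow_ne_top _)
      _ ≤ 2 ^ ((k : ℝ) * n) * (C * 2 ^ (((-k : ℤ) : ℝ) * (n + s)) * (maximalPow r G x + G z)) :=
          mul_le_mul_right (hC f G E hG hfm x z (-k) hz hzx) _
      _ ≤ 2 ^ ((k : ℝ) * n) * (C * 2 ^ (((-k : ℤ) : ℝ) * (n + s)) *
            (maximalPow r G x + maximalPow r G x)) := by gcongr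
      _ = (2 ^ ((k : ℝ) * n) * 2 ^ (((-k : ℤ) : ℝ) * (n + s))) *
            (C * (2 * maximalPow r G x)) := by ring
      _ = _ := by
          rw [← two_rpow_add]
          congr 2
          push_cast
          ring
  have e2 : ENNReal.ofReal ((2 : ℝ) ^ ((k : ℝ) * s)) = 2 ^ ((k : ℝ) * s) := by
    rw [Real.rpow_mul (by norm_num), Real.rpow_intCast, ofReal_two_zpow_rpow]
  calc _ ≤ 2 ^ ((k : ℝ) * s) * (2 ^ (-((k : ℝ) * s)) * (C * (2 * maximalPow r G x))) := by
        rw [e2]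
        exact mul_le_mul_right (iSup₂_le key) _
    _ = _ := by
        rw [← mul_assoc, ← two_rpow_add, add_neg_cancel, ENNReal.rpow_zero]
        push_cast
        ring

/-- The bound of the grand Triebel–Lizorkin norm by the norm of any Hajłasz gradient. -/
theorem exists_grandTLNorm_le {s p m : ℝ} (ℓ : ℕ) (hs : 0 < s) (hs1 : s ≤ 1)
    (hp : (n : ℝ) / (n + s) < p) (hm : (n : ℝ) + 1 < m) :
    ∃ C : ℝ≥0, 0 < C ∧ ∀ (f : Rn n → ℂ) (T : 𝓢'(Rn n, ℂ)) (g : Rn n → ℝ),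
      IsHajlaszGradient s f g → Represents f T →
        grandTLNorm (testClass n 0 ℓ m) s p T ≤ C * eLpNorm g (ENNReal.ofReal p) volume := by
  obtain ⟨r, hr, hr1, hrp, hrs⟩ := exists_order hs hp
  obtain ⟨C, hC⟩ := exists_grandMaximal_le (n := n) ℓ hs hs1 hr hr1 hrs hm
  obtain ⟨D, hD⟩ := exists_lintegral_maximalPow_rpow_le n hr hrp
  have hp0 : 0 < p := hr.trans hrp
  refine ⟨C * D ^ (1 / p) + 1, by positivity, fun f T g hg hT => ?_⟩
  obtain ⟨E, hG⟩ := hg.exists_isGradientOff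
  set G : Rn n → ℝ≥0∞ := fun x => ENNReal.ofReal (g x)
  rw [grandTLNorm_eq hp0, eLpNorm_ofReal_eq_of_nonneg hp0 hg.2.1]
  calc (∫⁻ x, grandMaximal (testClass n 0 ℓ m) s T x ^ p) ^ (1 / p)
      ≤ (∫⁻ x, (C * maximalPow r G x) ^ p) ^ (1 / p) := by
        gcongr with x
        exact hC f T G E hG hT x
    _ = (C ^ p * ∫⁻ x, maximalPow r G x ^ p) ^ (1 / p) := by
        simp_rw [ENNReal.mul_rpow_of_nonneg _ _ hp0.le]
        rw [lintegral_const_mul' _ _ (by finiteness)]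
    _ ≤ (C ^ p * (D * ∫⁻ x, G x ^ p)) ^ (1 / p) := by
        gcongr
        exact hD G hG.measurable
    _ = C * D ^ (1 / p) * (∫⁻ x, G x ^ p) ^ (1 / p) := by
        rw [ENNReal.mul_rpow_of_nonneg _ _ (by positivity),
          ENNReal.mul_rpow_of_nonneg _ _ (by positivity), ← ENNReal.rpow_mul,
          mul_one_div_cancel hp0.ne', ENNReal.rpow_one, mul_assoc]
    _ ≤ _ := by
        gcongr
        push_cast
        rw [ENNReal.coe_rpow_of_nonneg _ (by positivity)]
        exact le_self_add

end GrandMaximal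

/-! ### Bounds for the norms of test functions -/

section TestFunctions

variable {n : ℕ}

/-- Isolates the induction over the coordinates; it is applied to scalar multiplication and to `χ ↦
χ - translate h χ`. -/
theorem partialDeriv_comm (D : 𝓢(Rn n, ℂ) → 𝓢(Rn n, ℂ))
    (hD : ∀ (v : Rn n) (χ : 𝓢(Rn n, ℂ)), ∂_{v} (D χ) = D (∂_{v} χ)) (α : Fin n → ℕ)
    (φ : 𝓢(Rn n, ℂ)) : partialDeriv α (D φ) = D (partialDeriv α φ) := by
  unfold partialDeriv
  induction List.finRange n with
  | nil => rfl
  | cons i l ih =>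
    simp only [List.foldr_cons]
    rw [ih]
    exact ((Function.Commute.iterate_left
      (f := fun χ : 𝓢(Rn n, ℂ) => ∂_{EuclideanSpace.single i (1 : ℝ)} χ) (g := D)
      (fun χ => hD _ χ)) (α i)) _

theorem lineDerivOp_translate (v h : Rn n) (χ : 𝓢(Rn n, ℂ)) :
    ∂_{v} (translate h χ) = translate h (∂_{v} χ) := by
  ext y
  rw [SchwartzMap.lineDerivOp_apply_eq_fderiv, SchwartzMap.compSubConstCLM_apply,
    SchwartzMap.lineDerivOp_apply_eq_fderiv]
  have : (translate h χ : Rn n → ℂ) = fun y => χ (y - h) := by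
    ext y; simp
  rw [this, fderiv_comp_sub]

theorem partialDeriv_smul (c : ℂ) (α : Fin n → ℕ) (φ : 𝓢(Rn n, ℂ)) :
    partialDeriv α (c • φ) = c • partialDeriv α φ :=
  partialDeriv_comm (fun χ => c • χ)
    (fun v χ => (LineDeriv.lineDerivOpCLM ℂ 𝓢(Rn n, ℂ) v).map_smul c χ) α φ

theorem partialDeriv_sub_translate (h : Rn n) (α : Fin n → ℕ) (φ : 𝓢(Rn n, ℂ)) :
    partialDeriv α (φ - translate h φ) = partialDeriv α φ - translate h (partialDeriv α φ) :=
  partialDeriv_comm (fun χ => χ - translate h χ)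
    (fun v χ => by
      rw [← lineDerivOp_translate]
      exact (LineDeriv.lineDerivOpCLM ℂ 𝓢(Rn n, ℂ) v).map_sub χ _) α φ

theorem schwartzNorm_smul_le (k : ℕ) (m : ℝ) (c : ℂ) (φ : 𝓢(Rn n, ℂ)) :
    schwartzNorm k m (c • φ) ≤ ‖c‖ₑ * schwartzNorm k m φ := by
  refine iSup₂_le fun α hα => iSup_le fun x => ?_
  rw [partialDeriv_smul, smul_apply, enorm_smul, mul_left_comm]
  refine mul_le_mul_right (le_iSup₂_of_le α hα ?_) _
  exact le_iSup (fun x => ENNReal.ofReal ((1 + ‖x‖) ^ m) * ‖partialDeriv α φ x‖ₑ) x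

theorem finite_setOf_sum_le (n K : ℕ) : {α : Fin n → ℕ | ∑ i, α i ≤ K}.Finite := by
  refine (Set.finite_Iic (fun _ : Fin n => K)).subset fun α hα i => ?_
  exact (Finset.single_le_sum (fun _ _ => Nat.zero_le _) (Finset.mem_univ i)).trans hα

/-- Only finitely many multi-indices occur, so constants chosen separately for each of them suffice,
uniformly over the family. -/
theorem exists_schwartzNorm_le {ι : Type*} (K : ℕ) (m : ℝ) (ψ : ι → 𝓢(Rn n, ℂ)) (w : ι → ℝ≥0∞)
    (h : ∀ α, ∃ C : ℝ≥0, ∀ i x,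
      ENNReal.ofReal ((1 + ‖x‖) ^ m) * ‖partialDeriv α (ψ i) x‖ₑ ≤ C * w i) :
    ∃ C : ℝ≥0, 0 < C ∧ ∀ i, schwartzNorm K m (ψ i) ≤ C * w i := by
  choose C hC using h
  set S := (finite_setOf_sum_le n K).toFinset
  -- The summand 1 makes the constant positive, as needed when test functions are normalized by it.
  refine ⟨∑ α ∈ S, C α + 1, by positivity, fun i => iSup₂_le fun α hα => iSup_le fun x => ?_⟩
  refine (hC α i x).trans ?_
  gcongr
  have hα' : α ∈ S := by simpa [S] using hα
  exact (Finset.single_le_sum (fun _ _ => zero_le) hα').trans le_self_add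

theorem rpow_le_pow_ceil (x : Rn n) (m : ℝ) : (1 + ‖x‖) ^ m ≤ (1 + ‖x‖) ^ ⌈m⌉₊ := by
  rw [← Real.rpow_natCast]
  exact Real.rpow_le_rpow_of_exponent_le (by linarith [norm_nonneg x]) (Nat.le_ceil m)

theorem exists_ofReal_rpow_mul_enorm_le (m : ℝ) (χ : 𝓢(Rn n, ℂ)) :
    ∃ C : ℝ≥0, ∀ x, ENNReal.ofReal ((1 + ‖x‖) ^ m) * ‖χ x‖ₑ ≤ C := by
  obtain ⟨C, hC0, hC⟩ := one_add_norm_pow_mul_iteratedFDeriv_comp_sub_le ⌈m⌉₊ 0 χ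
  refine ⟨C.toNNReal, fun x => ?_⟩
  have h := hC x 0
  rw [norm_iteratedFDeriv_zero, sub_zero, norm_zero, add_zero, one_pow, mul_one] at h
  rw [← ofReal_norm, ← ENNReal.ofReal_mul (by positivity)]
  refine ENNReal.ofReal_le_ofReal (le_trans ?_ h)
  gcongr
  exact rpow_le_pow_ceil x m

theorem exists_ofReal_rpow_mul_enorm_sub_le (m : ℝ) (χ : 𝓢(Rn n, ℂ)) :
    ∃ C : ℝ≥0, ∀ h : Rn n, ‖h‖ ≤ 1 → ∀ x,
      ENNReal.ofReal ((1 + ‖x‖) ^ m) * ‖χ x - χ (x - h)‖ₑ ≤ C * ‖h‖ₑ := by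
  obtain ⟨C, hC0, hC⟩ := one_add_norm_pow_mul_iteratedFDeriv_sub_le ⌈m⌉₊ 0 χ 1
  refine ⟨C.toNNReal, fun h hh x => ?_⟩
  have h1 := hC x 0 (by simp) h (by simpa using hh)
  rw [iteratedFDeriv_zero_eq_comp, Function.comp_apply, Function.comp_apply, ← map_sub,
    LinearIsometryEquiv.norm_map, zero_sub, norm_neg, sub_zero] at h1
  rw [← ofReal_norm, ← ofReal_norm, ← ENNReal.ofReal_mul (by positivity)]
  refine (ENNReal.ofReal_le_ofReal (le_trans ?_ h1)).trans (le_of_eq (ENNReal.ofReal_mul hC0))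
  gcongr
  exact rpow_le_pow_ceil x m

theorem exists_schwartzNorm_lt_top (K : ℕ) (m : ℝ) (φ : 𝓢(Rn n, ℂ)) :
    ∃ C : ℝ≥0, 0 < C ∧ schwartzNorm K m φ ≤ C := by
  obtain ⟨C, hC0, hC⟩ := exists_schwartzNorm_le K m (fun _ : Unit => φ) (fun _ => 1) fun α => by
    obtain ⟨C, hC⟩ := exists_ofReal_rpow_mul_enorm_le m (partialDeriv α φ)
    exact ⟨C, fun _ x => by simpa using hC x⟩
  exact ⟨C, hC0, by simpa using hC ()⟩

theorem exists_schwartzNorm_sub_translate_le (K : ℕ) (m : ℝ) (φ : 𝓢(Rn n, ℂ)) :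
    ∃ C : ℝ≥0, 0 < C ∧ ∀ h : Rn n, ‖h‖ ≤ 1 →
      schwartzNorm K m (φ - translate h φ) ≤ C * ‖h‖ₑ := by
  obtain ⟨C, hC0, hC⟩ := exists_schwartzNorm_le K m
    (fun h : {h : Rn n // ‖h‖ ≤ 1} => φ - translate h.1 φ) (fun h => ‖h.1‖ₑ) fun α => by
      obtain ⟨C, hC⟩ := exists_ofReal_rpow_mul_enorm_sub_le m (partialDeriv α φ)
      refine ⟨C, fun h x => ?_⟩
      rw [partialDeriv_sub_translate]
      simpa using hC h.1 h.2 x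
  exact ⟨C, hC0, fun h hh => hC ⟨h, hh⟩⟩

end TestFunctions

/-! ### Convolutions with dilated test functions -/

section Convolutions

variable {n : ℕ}

theorem conv_sub (φ ψ : 𝓢(Rn n, ℂ)) (T : 𝓢'(Rn n, ℂ)) (x : Rn n) :
    conv (φ - ψ) T x = conv φ T x - conv ψ T x := by
  simp [conv, reflectTranslate]

theorem conv_smul (c : ℂ) (φ : 𝓢(Rn n, ℂ)) (T : 𝓢'(Rn n, ℂ)) (x : Rn n) :
    conv (c • φ) T x = c * conv φ T x := by
  simp [conv, reflectTranslate]

theorem dilate_sub {t : ℝ} (ht : 0 < t) (φ ψ : 𝓢(Rn n, ℂ)) :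
    dilate t ht (φ - ψ) = dilate t ht φ - dilate t ht ψ := by
  simp [dilate, smul_sub]

theorem dilate_smul {t : ℝ} (ht : 0 < t) (c : ℂ) (φ : 𝓢(Rn n, ℂ)) :
    dilate t ht (c • φ) = c • dilate t ht φ := by
  simp [dilate, smul_comm c]

theorem dilate_dilate {t u : ℝ} (ht : 0 < t) (hu : 0 < u) (φ : 𝓢(Rn n, ℂ)) :
    dilate t ht (dilate u hu φ) = dilate (t * u) (mul_pos ht hu) φ := by
  ext x
  rw [dilate_apply, dilate_apply, dilate_apply, smul_smul, smul_smul, mul_pow, mul_inv, mul_inv,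
    mul_comm u⁻¹]

theorem integral_dilate {t : ℝ} (ht : 0 < t) (φ : 𝓢(Rn n, ℂ)) :
    ∫ x, dilate t ht φ x = ∫ x, φ x := by
  rw [← integral_reflectTranslate_dilate φ ht 0,
    ← integral_neg_eq_self fun x => dilate t ht φ x]
  simp [reflectTranslate_apply]

theorem continuous_conv (φ : 𝓢(Rn n, ℂ)) (T : 𝓢'(Rn n, ℂ)) : Continuous (conv φ T) :=
  continuous_apply_translate T _

/-- The supremum over `A` may be uncountable, but a supremum of continuous functions is lower
semicontinuous. -/
theorem measurable_grandMaximal (A : Set 𝓢(Rn n, ℂ)) (s : ℝ) (T : 𝓢'(Rn n, ℂ)) :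
    Measurable (grandMaximal A s T) := by
  refine Measurable.iSup fun k => Measurable.const_mul ?_ _
  refine LowerSemicontinuous.measurable (lowerSemicontinuous_biSup fun φ _ => ?_)
  exact (continuous_conv _ T).enorm.lowerSemicontinuous

/-- Homogeneity: `ψ` divided by `c` belongs to the test class, and convolution is linear in the test
function. -/
theorem enorm_conv_dilate_le {ℓ : ℕ} {m s : ℝ} {ψ : 𝓢(Rn n, ℂ)} (hψ : ∫ x, ψ x = 0) {c : ℝ≥0}
    (hc : 0 < c) (hψc : schwartzNorm (ℓ + 1) m ψ ≤ c) (T : 𝓢'(Rn n, ℂ)) (k : ℤ) (x : Rn n)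
    (hk : (0 : ℝ) < 2 ^ (-k)) :
    ‖conv (dilate ((2 : ℝ) ^ (-k)) hk ψ) T x‖ₑ ≤
      c * 2 ^ (-((k : ℝ) * s)) * grandMaximal (testClass n 0 ℓ m) s T x := by
  have hc' : (c : ℂ) ≠ 0 := by exact_mod_cast hc.ne'
  have hcn : ‖(c : ℂ)‖ₑ = c := by
    rw [← ofReal_norm]; simp
  have hmem : (c : ℂ)⁻¹ • ψ ∈ testClass n 0 ℓ m := by
    refine ⟨fun α hα => ?_, ?_⟩
    · have h0 : ∀ i, α i = 0 := by simpa using hα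
      simp only [h0, pow_zero, Finset.prod_const_one, one_mul, smul_apply]
      rw [integral_smul, hψ, smul_zero]
    · rw [zero_add]
      calc _ ≤ _ := schwartzNorm_smul_le _ _ _ _
        _ ≤ (c : ℝ≥0∞)⁻¹ * c := by
          rw [enorm_inv hc', hcn]
          exact mul_le_mul_right hψc _
        _ = 1 := ENNReal.inv_mul_cancel (by exact_mod_cast hc.ne') ENNReal.coe_ne_top
  have h1 : ENNReal.ofReal ((2 : ℝ) ^ ((k : ℝ) * s)) *
      ‖conv (dilate ((2 : ℝ) ^ (-k)) hk ((c : ℂ)⁻¹ • ψ)) T x‖ₑ ≤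
        grandMaximal (testClass n 0 ℓ m) s T x := by
    refine le_trans ?_ (le_iSup _ k)
    exact mul_le_mul_right (le_iSup₂ (f := fun φ (_ : φ ∈ testClass n 0 ℓ m) =>
      ‖conv (dilate ((2 : ℝ) ^ (-k)) hk φ) T x‖ₑ) _ hmem) _
  rw [Real.rpow_mul (by norm_num), Real.rpow_intCast, ofReal_two_zpow_rpow] at h1
  have h2 : conv (dilate ((2 : ℝ) ^ (-k)) hk ψ) T x =
      c * conv (dilate ((2 : ℝ) ^ (-k)) hk ((c : ℂ)⁻¹ • ψ)) T x := by
    rw [dilate_smul, conv_smul, mul_inv_cancel_left₀ hc']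
  rw [h2, enorm_mul, hcn, mul_assoc]
  refine mul_le_mul_right ?_ _
  calc _ = 2 ^ (-((k : ℝ) * s)) * (2 ^ ((k : ℝ) * s) *
        ‖conv (dilate ((2 : ℝ) ^ (-k)) hk ((c : ℂ)⁻¹ • ψ)) T x‖ₑ) := by
        rw [← mul_assoc, ← two_rpow_add, neg_add_cancel, ENNReal.rpow_zero, one_mul]
    _ ≤ _ := mul_le_mul_right h1 _

/-- The mollification `φ_{2^{-k}} * T`. -/
noncomputable def mollify (φ : 𝓢(Rn n, ℂ)) (T : 𝓢'(Rn n, ℂ)) (k : ℤ) (x : Rn n) : ℂ :=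
  conv (dilate ((2 : ℝ) ^ (-k)) (by positivity) φ) T x

theorem continuous_mollify (φ : 𝓢(Rn n, ℂ)) (T : 𝓢'(Rn n, ℂ)) (k : ℤ) :
    Continuous (mollify φ T k) :=
  continuous_conv _ T

/-- The difference is the convolution of `T` with the `2 ^ (-k)` dilate of the fixed function
`dilate 2⁻¹ φ - φ`, whose integral vanishes. -/
theorem exists_enorm_mollify_succ_sub_le (φ : 𝓢(Rn n, ℂ)) (ℓ : ℕ) (m s : ℝ) :
    ∃ C : ℝ≥0, ∀ (T : 𝓢'(Rn n, ℂ)) (k : ℤ) (x : Rn n),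
      ‖mollify φ T (k + 1) x - mollify φ T k x‖ₑ ≤
        C * 2 ^ (-((k : ℝ) * s)) * grandMaximal (testClass n 0 ℓ m) s T x := by
  have h2 : (0 : ℝ) < 2⁻¹ := by norm_num
  obtain ⟨C, hC0, hC⟩ := exists_schwartzNorm_lt_top (ℓ + 1) m (dilate 2⁻¹ h2 φ - φ)
  refine ⟨C, fun T k x => ?_⟩
  have hk : (0 : ℝ) < 2 ^ (-k) := by positivity
  have e : mollify φ T (k + 1) x - mollify φ T k x =
      conv (dilate ((2 : ℝ) ^ (-k)) hk (dilate 2⁻¹ h2 φ - φ)) T x := by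
    rw [dilate_sub, conv_sub, dilate_dilate]
    have : (2 : ℝ) ^ (-(k + 1)) = 2 ^ (-k) * 2⁻¹ := by
      rw [neg_add, zpow_add₀ (by norm_num), zpow_neg_one]
    simp only [mollify, this]
  rw [e]
  refine enorm_conv_dilate_le ?_ hC0 hC T k x hk
  simp only [sub_apply]
  rw [integral_sub (SchwartzMap.integrable _) φ.integrable, integral_dilate, sub_self]

/-- With `h = 2 ^ k • (x - y)`, the difference is the convolution at `x` with the dilate of `φ -
translate h φ`, which has mean zero and Schwartz norm at most a multiple of `‖h‖`. The bound
involves the grand maximal function at `x` alone. -/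
theorem exists_enorm_mollify_sub_le (φ : 𝓢(Rn n, ℂ)) (ℓ : ℕ) (m s : ℝ) :
    ∃ C : ℝ≥0, ∀ (T : 𝓢'(Rn n, ℂ)) (k : ℤ) (x y : Rn n), dist x y ≤ 2 ^ (-k) →
      ‖mollify φ T k x - mollify φ T k y‖ₑ ≤ C * ENNReal.ofReal (2 ^ k * dist x y) *
        2 ^ (-((k : ℝ) * s)) * grandMaximal (testClass n 0 ℓ m) s T x := by
  obtain ⟨C, hC0, hC⟩ := exists_schwartzNorm_sub_translate_le (ℓ + 1) m φ
  refine ⟨C, fun T k x y hxy => ?_⟩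
  -- The case `x = y` is separated because the normalizing constant `C * ‖h‖` has to be positive.
  rcases eq_or_ne x y with rfl | hne
  · simp
  have hk : (0 : ℝ) < 2 ^ (-k) := by positivity
  set h : Rn n := ((2 : ℝ) ^ k) • (x - y) with hh
  have hnorm : ‖h‖ = 2 ^ k * dist x y := by
    rw [hh, norm_smul, Real.norm_of_nonneg (by positivity), dist_eq_norm]
  have hh1 : ‖h‖ ≤ 1 := by
    rw [hnorm]
    calc _ ≤ (2 : ℝ) ^ k * 2 ^ (-k) := by gcongr
      _ = 1 := by rw [← zpow_add₀ (by norm_num), add_neg_cancel, zpow_zero]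
  have hpos : 0 < ‖h‖₊ := by
    rw [← NNReal.coe_pos, coe_nnnorm, hnorm]
    have := dist_pos.2 hne
    positivity
  have e : mollify φ T k x - mollify φ T k y =
      conv (dilate ((2 : ℝ) ^ (-k)) hk (φ - translate h φ)) T x := by
    rw [dilate_sub, conv_sub, mollify, mollify]
    congr 1
    unfold conv
    congr 1
    ext z
    rw [reflectTranslate_apply, reflectTranslate_apply, dilate_apply, dilate_apply,
      SchwartzMap.compSubConstCLM_apply, hh]
    congr 2
    rw [zpow_neg, inv_inv, ← smul_sub]
    congr 1
    abel
  have hCh : schwartzNorm (ℓ + 1) m (φ - translate h φ) ≤ (C * ‖h‖₊ : ℝ≥0) := by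
    rw [ENNReal.coe_mul]
    exact hC h hh1
  have h0 : ∫ z, (φ - translate h φ) z = 0 := by
    simp only [sub_apply]
    rw [integral_sub φ.integrable (SchwartzMap.integrable _)]
    simp only [SchwartzMap.compSubConstCLM_apply]
    rw [integral_sub_right_eq_self (fun z => φ z) h, sub_self]
  rw [e]
  refine (enorm_conv_dilate_le (s := s) h0 (mul_pos hC0 hpos) hCh T k x hk).trans (le_of_eq ?_)
  rw [ENNReal.coe_mul, ← hnorm, ofReal_norm]
  rfl

/-- The mollifications of a tempered distribution converge to it. -/
theorem tendsto_integral_mul_mollify {φ : 𝓢(Rn n, ℂ)} (hφ : ∫ x, φ x = 1) (T : 𝓢'(Rn n, ℂ))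
    (ψ : 𝓢(Rn n, ℂ)) :
    Filter.Tendsto (fun k : ℕ => ∫ x, ψ x * mollify φ T k x) Filter.atTop (nhds (T ψ)) := by
  set φ' : 𝓢(Rn n, ℂ) := reflectTranslate 0 φ with hφ'
  have hφ'_apply : ∀ w, φ' w = φ (-w) := fun w => by simp [φ', reflectTranslate_apply]
  -- The integral is `T` applied to the convolution of `ψ` with the reflected dilate `b`. Commuting
  -- the factors moves the translation onto `ψ`, and the substitution `z = t • w` moves the scale
  -- there too, ready for dominated convergence.
  have key : ∀ k : ℕ, ∫ x, ψ x * mollify φ T k x =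
      ∫ w, φ' w * T (translate (((2 : ℝ) ^ (-(k : ℤ))) • w) ψ) := fun k => by
    have hk : (0 : ℝ) < 2 ^ (-(k : ℤ)) := by positivity
    set t : ℝ := 2 ^ (-(k : ℤ)) with ht
    set b := SchwartzMap.compCLMOfContinuousLinearEquiv ℂ
      (ContinuousLinearEquiv.neg ℝ (M := Rn n)) (dilate t hk φ) with hb
    have h1 : ∫ x, ψ x * mollify φ T k x = T (schwartzConv ψ b) :=
      (apply_schwartzConv T ψ b).symm
    rw [h1, schwartzConv_comm, apply_schwartzConv]
    set F : Rn n → ℂ := fun w => φ' w * T (translate (t • w) ψ) with hF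
    have h2 : (fun z => b z * T (translate z ψ)) = fun z => ((t ^ n)⁻¹ : ℝ) • F (t⁻¹ • z) := by
      funext z
      have : b z = dilate t hk φ (-z) := rfl
      simp only [hF, this, dilate_apply, hφ'_apply, smul_neg, smul_inv_smul₀ hk.ne',
        smul_mul_assoc]
    rw [h2, integral_smul, Measure.integral_comp_inv_smul_of_nonneg _ F hk.le,
      finrank_euclideanSpace,
      Fintype.card_fin, smul_smul, inv_mul_cancel₀ (by positivity), one_smul]
  simp_rw [key]
  obtain ⟨C, N, hC0, hC⟩ := exists_norm_apply_translate_le T ψ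
  have hlim : T ψ = ∫ w, φ' w * T ψ := by
    rw [integral_mul_const]
    simp_rw [hφ'_apply]
    rw [integral_neg_eq_self fun w => φ w, hφ, one_mul]
  rw [hlim]
  refine tendsto_integral_of_dominated_convergence
    (fun w => C * ((1 + ‖w‖) ^ N * ‖φ' w‖)) (fun k => ?_)
    ((integrable_one_add_norm_pow_mul φ' N).const_mul C) (fun k => ?_) ?_
  · exact (φ'.continuous.mul ((continuous_apply_translate T ψ).comp
      (by fun_prop))).aestronglyMeasurable
  · refine Filter.Eventually.of_forall fun w => ?_
    rw [norm_mul]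
    have h1 : ‖((2 : ℝ) ^ (-(k : ℤ))) • w‖ ≤ ‖w‖ := by
      rw [norm_smul, Real.norm_of_nonneg (by positivity)]
      refine mul_le_of_le_one_left (norm_nonneg w) ?_
      exact zpow_le_one_of_nonpos₀ (by norm_num) (by simp)
    calc _ ≤ ‖φ' w‖ * (C * (1 + ‖((2 : ℝ) ^ (-(k : ℤ))) • w‖) ^ N) := by gcongr; exact hC _
      _ ≤ ‖φ' w‖ * (C * (1 + ‖w‖) ^ N) := by gcongr
      _ = _ := by ring
  · refine Filter.Eventually.of_forall fun w => Filter.Tendsto.const_mul _ ?_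
    have h1 : Filter.Tendsto (fun k : ℕ => ((2 : ℝ) ^ (-(k : ℤ))) • w) Filter.atTop
        (nhds ((0 : ℝ) • w)) := by
      refine Filter.Tendsto.smul_const ?_ w
      simp_rw [zpow_neg, zpow_natCast]
      exact tendsto_inv_atTop_zero.comp (tendsto_pow_atTop_atTop_of_one_lt one_lt_two)
    rw [zero_smul] at h1
    have h2 := ((continuous_apply_translate T ψ).tendsto 0).comp h1
    have h3 : translate 0 ψ = ψ := by
      ext y
      simp
    rwa [h3] at h2

theorem integrable_mul_mollify (φ : 𝓢(Rn n, ℂ)) (T : 𝓢'(Rn n, ℂ)) (k : ℤ) (ψ : 𝓢(Rn n, ℂ)) :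
    Integrable fun x => ψ x * mollify φ T k x :=
  integrable_smul_translate (V := ℂ) ⟨T.toLinearMap, T.continuous⟩ ψ _

/-- The complex valued Schwartz function given by a smooth compactly supported real function. -/
theorem exists_schwartz_eq_ofReal {g : Rn n → ℝ} (hg : ContDiff ℝ (⊤ : ℕ∞) g)
    (hc : HasCompactSupport g) : ∃ ψ : 𝓢(Rn n, ℂ), ∀ x, ψ x = g x := by
  have h1 : HasCompactSupport fun x => (g x : ℂ) :=
    hc.comp_left (g := fun t : ℝ => (t : ℂ)) (by simp)
  exact ⟨h1.toSchwartzMap (Complex.ofRealCLM.contDiff.comp hg), fun x => rfl⟩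

theorem exists_schwartz_integral_eq_one (n : ℕ) : ∃ φ : 𝓢(Rn n, ℂ), ∫ x, φ x = 1 := by
  let b : ContDiffBump (0 : Rn n) := ⟨1, 2, one_pos, one_lt_two⟩
  obtain ⟨φ, hφ⟩ := exists_schwartz_eq_ofReal (b.contDiff_normed (μ := volume))
    b.hasCompactSupport_normed
  refine ⟨φ, ?_⟩
  simp_rw [hφ]
  exact (integral_complex_ofReal).trans (by rw [b.integral_normed, Complex.ofReal_one])

end Convolutions

/-! ### From the grand maximal function to Hajłasz gradients -/

section Limits

theorem tendsto_two_rpow_neg {δ : ℝ} (hδ : 0 < δ) :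
    Filter.Tendsto (fun k : ℕ => (2 : ℝ≥0∞) ^ (-(k * δ))) Filter.atTop (nhds 0) :=
  ENNReal.tendsto_atTop_zero_of_tsum_ne_top (tsum_two_rpow_neg hδ)

theorem exists_limit_of_enorm_succ_sub_le {s : ℝ} (hs : 0 < s) (u : ℤ → ℂ) {M : ℝ≥0∞}
    (hM : M ≠ ∞) (h : ∀ k : ℤ, ‖u (k + 1) - u k‖ₑ ≤ 2 ^ (-((k : ℝ) * s)) * M) :
    ∃ z, Filter.Tendsto (fun k : ℕ => u k) Filter.atTop (nhds z) ∧
      ∀ k : ℤ, ‖z - u k‖ₑ ≤ (∑' i : ℕ, (2 : ℝ≥0∞) ^ (-(i * s))) * 2 ^ (-((k : ℝ) * s)) * M := by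
  have step : ∀ (k : ℤ) (i : ℕ), edist (u (k + i)) (u (k + (i + 1 : ℕ))) ≤
      (2 : ℝ≥0∞) ^ (-(i * s)) * (2 ^ (-((k : ℝ) * s)) * M) := fun k i => by
    have e : k + ((i + 1 : ℕ) : ℤ) = k + i + 1 := by push_cast; ring
    rw [edist_comm, edist_eq_enorm_sub, e]
    refine (h (k + i)).trans (le_of_eq ?_)
    rw [← mul_assoc, ← two_rpow_add]
    congr 2
    push_cast
    ring
  have hsum : ∀ k : ℤ, ∑' i : ℕ, (2 : ℝ≥0∞) ^ (-(i * s)) * (2 ^ (-((k : ℝ) * s)) * M) ≠ ∞ :=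
    fun k => by
      rw [ENNReal.tsum_mul_right]
      exact ENNReal.mul_ne_top (tsum_two_rpow_neg hs)
        (ENNReal.mul_ne_top (two_rpow_ne_top _) hM)
  have hc := cauchySeq_of_edist_le_of_tsum_ne_top _ (step 0) (hsum 0)
  obtain ⟨z, hz⟩ := cauchySeq_tendsto_of_complete hc
  simp only [zero_add] at hz
  refine ⟨z, hz, fun k => ?_⟩
  -- The limit is taken along all integers so that the telescoping may start at a negative `k`:
  -- points far apart are compared at such scales.
  have hz' : Filter.Tendsto u Filter.atTop (nhds z) := by
    rw [← Nat.map_cast_int_atTop]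
    exact hz
  have hk : Filter.Tendsto (fun i : ℕ => u (k + i)) Filter.atTop (nhds z) :=
    hz'.comp (Filter.tendsto_atTop_add_const_left _ k tendsto_natCast_atTop_atTop)
  have := edist_le_tsum_of_edist_le_of_tendsto₀ _ (step k) hk
  rw [ENNReal.tsum_mul_right, edist_comm, edist_eq_enorm_sub] at this
  simpa [mul_assoc] using this

end Limits

/-! ### Gradients of limits and of approximation errors -/

section Approximation

variable {n : ℕ} {s : ℝ} {f : Rn n → ℂ} {u : ℤ → Rn n → ℂ} {G : Rn n → ℝ≥0∞} {E : Set (Rn n)}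
  {K L : ℝ≥0∞}

/-- A function which is the limit of functions varying at the scales `2 ^ (-k)` has a Hajłasz
gradient. -/
theorem isGradientOff_of_approx (hK : K ≠ ∞) (hL : L ≠ ∞) (hG : Measurable G)
    (hE : volume E = 0) (hGE : ∀ x ∉ E, G x ≠ ∞) (hs : 0 < s)
    (hf : ∀ x ∉ E, ∀ k : ℤ, ‖f x - u k x‖ₑ ≤ K * 2 ^ (-((k : ℝ) * s)) * G x)
    (hu : ∀ (k : ℤ) (x y : Rn n), dist x y ≤ 2 ^ (-k) → ‖u k x - u k y‖ₑ ≤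
      L * ENNReal.ofReal (2 ^ k * dist x y) * 2 ^ (-((k : ℝ) * s)) * G x) :
    IsGradientOff s f (fun x => 2 ^ s * (K + L) * G x) E := by
  refine ⟨hG.const_mul _, hE, fun x hx => ?_, fun x hx y hy => ?_⟩
  · have := hGE x hx
    have := two_rpow_ne_top s
    finiteness
  rcases eq_or_ne x y with rfl | hne
  · simp
  -- The scale satisfies `dist x y ≤ 2 ^ (-k) < 2 * dist x y`. The left inequality makes the bound
  -- for `u k` available, and the right one produces the factor `2 ^ s`.
  obtain ⟨j, hj, hj'⟩ := exists_mem_Ioc_zpow (dist_pos.2 hne) (one_lt_two (α := ℝ))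
  set k : ℤ := -(j + 1) with hk
  have hd : dist x y ≤ 2 ^ (-k) := by rw [hk, neg_neg]; exact hj'
  have hkd : ENNReal.ofReal (2 ^ k * dist x y) ≤ 1 := by
    rw [← ENNReal.ofReal_one]
    refine ENNReal.ofReal_le_ofReal ?_
    calc _ ≤ (2 : ℝ) ^ k * 2 ^ (-k) := by gcongr
      _ = 1 := by rw [← zpow_add₀ (by norm_num), add_neg_cancel, zpow_zero]
  have hpow : (2 : ℝ≥0∞) ^ (-((k : ℝ) * s)) ≤ 2 ^ s * ENNReal.ofReal (dist x y ^ s) := by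
    have : -((k : ℝ) * s) = s + j * s := by rw [hk]; push_cast; ring
    rw [this, two_rpow_add, ← ofReal_two_zpow_rpow]
    gcongr
  have hsplit : f x - f y = (f x - u k x) + (u k x - u k y) + (u k y - f y) := by ring
  have hy' : ‖u k y - f y‖ₑ ≤ K * 2 ^ (-((k : ℝ) * s)) * G y := by
    rw [← enorm_neg, neg_sub]
    exact hf y hy k
  calc ‖f x - f y‖ₑ ≤ ‖f x - u k x‖ₑ + ‖u k x - u k y‖ₑ + ‖u k y - f y‖ₑ := by
        rw [hsplit]
        exact (enorm_add_le _ _).trans (add_le_add_left (enorm_add_le _ _) _)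
    _ ≤ K * 2 ^ (-((k : ℝ) * s)) * G x + L * 1 * 2 ^ (-((k : ℝ) * s)) * G x +
        (K * 2 ^ (-((k : ℝ) * s)) * G y + L * 2 ^ (-((k : ℝ) * s)) * G y) := by
        refine add_le_add (add_le_add (hf x hx k) ((hu k x y hd).trans ?_))
          (hy'.trans le_self_add)
        gcongr
    _ = 2 ^ (-((k : ℝ) * s)) * ((K + L) * G x + (K + L) * G y) := by ring
    _ ≤ 2 ^ s * ENNReal.ofReal (dist x y ^ s) * ((K + L) * G x + (K + L) * G y) := by gcongr
    _ = _ := by ring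

/-- The error of approximation has a small Hajłasz gradient of any smaller order. -/
theorem isGradientOff_sub_of_approx (hK : K ≠ ∞) (hL : L ≠ ∞) (hG : Measurable G)
    (hE : volume E = 0) (hGE : ∀ x ∉ E, G x ≠ ∞) {s' : ℝ} (hs' : 0 < s') (hss' : s' < s)
    (hs1 : s ≤ 1)
    (hf : ∀ x ∉ E, ∀ k : ℤ, ‖f x - u k x‖ₑ ≤ K * 2 ^ (-((k : ℝ) * s)) * G x)
    (hu : ∀ (k : ℤ) (x y : Rn n), dist x y ≤ 2 ^ (-k) → ‖u k x - u k y‖ₑ ≤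
      L * ENNReal.ofReal (2 ^ k * dist x y) * 2 ^ (-((k : ℝ) * s)) * G x) (k : ℤ) :
    IsGradientOff s' (fun x => f x - u k x)
      (fun x => (2 ^ s * (K + L) + (K + L)) * 2 ^ (-((k : ℝ) * (s - s'))) * G x) E := by
  have hs : 0 < s := hs'.trans hss'
  have hgrad := isGradientOff_of_approx hK hL hG hE hGE hs hf hu
  refine ⟨hG.const_mul _, hE, fun x hx => ?_, fun x hx y hy => ?_⟩
  · have := hGE x hx
    have := two_rpow_ne_top s
    have := two_rpow_ne_top (-((k : ℝ) * (s - s')))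
    finiteness
  rcases eq_or_ne x y with rfl | hne
  · simp
  have hd0 := dist_pos.2 hne
  set d := dist x y with hd
  set P : ℝ≥0∞ := 2 ^ (-((k : ℝ) * (s - s'))) with hP
  have hsplit : (2 : ℝ≥0∞) ^ (-((k : ℝ) * s)) = P * 2 ^ (((-k : ℤ) : ℝ) * s') := by
    rw [hP, ← two_rpow_add]
    congr 1
    push_cast
    ring
  -- Nearby points: `f` and `u k` are estimated separately, and since `d ≤ 2 ^ (-k)` the surplus `d
  -- ^ (s - s')` is at most `P`. Distant points: the errors at `x` and `y` are each small enough.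
  rcases le_or_gt d (2 ^ (-k)) with hdk | hdk
  · have h1 : ENNReal.ofReal (d ^ s) ≤ P * ENNReal.ofReal (d ^ s') := by
      have : d ^ s = d ^ (s - s') * d ^ s' := by
        rw [← Real.rpow_add hd0, sub_add_cancel]
      rw [this, ENNReal.ofReal_mul (by positivity)]
      gcongr
      have hP' : P = 2 ^ (((-k : ℤ) : ℝ) * (s - s')) := by
        rw [hP]
        congr 1
        push_cast
        ring
      rw [hP', ← ofReal_two_zpow_rpow]
      refine ENNReal.ofReal_le_ofReal (Real.rpow_le_rpow hd0.le hdk (by linarith))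
    have hkd : 2 ^ k * d ≤ 1 := by
      calc _ ≤ (2 : ℝ) ^ k * 2 ^ (-k) := by gcongr
        _ = 1 := by rw [← zpow_add₀ (by norm_num), add_neg_cancel, zpow_zero]
    have h2 : ENNReal.ofReal (2 ^ k * d) * 2 ^ (-((k : ℝ) * s)) ≤
        P * ENNReal.ofReal (d ^ s') := by
      -- A number in `[0, 1]` is at most its power of order `s' ≤ 1`; this converts the Lipschitz
      -- bound for `u k` into one of order `s'`.
      have : 2 ^ k * d ≤ ((2 : ℝ) ^ k) ^ s' * d ^ s' := by
        rw [← Real.mul_rpow (by positivity) hd0.le]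
        exact Real.self_le_rpow_of_le_one (by positivity) hkd (by linarith)
      calc _ ≤ ENNReal.ofReal (((2 : ℝ) ^ k) ^ s' * d ^ s') * 2 ^ (-((k : ℝ) * s)) := by gcongr
        _ = 2 ^ ((k : ℝ) * s' + -((k : ℝ) * s)) * ENNReal.ofReal (d ^ s') := by
            rw [ENNReal.ofReal_mul (by positivity), ofReal_two_zpow_rpow, two_rpow_add]
            ring
        _ = _ := by
            rw [hP]
            congr 2
            ring
    calc ‖f x - u k x - (f y - u k y)‖ₑ ≤ ‖f x - f y‖ₑ + ‖u k x - u k y‖ₑ := by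
          rw [show f x - u k x - (f y - u k y) = f x - f y - (u k x - u k y) by ring]
          exact enorm_sub_le
      _ ≤ ENNReal.ofReal (d ^ s) * (2 ^ s * (K + L) * G x + 2 ^ s * (K + L) * G y) +
          L * (ENNReal.ofReal (2 ^ k * d) * 2 ^ (-((k : ℝ) * s))) * G x := by
          refine add_le_add (hgrad.le x hx y hy) ((hu k x y hdk).trans (le_of_eq ?_))
          ring
      _ ≤ P * ENNReal.ofReal (d ^ s') * (2 ^ s * (K + L) * G x + 2 ^ s * (K + L) * G y) +
          (K + L) * (P * ENNReal.ofReal (d ^ s')) * (G x + G y) := by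
          gcongr
          · exact le_add_self
          · exact le_self_add
      _ = _ := by ring
  · have h1 : (2 : ℝ≥0∞) ^ (-((k : ℝ) * s)) ≤ P * ENNReal.ofReal (d ^ s') := by
      rw [hsplit, ← ofReal_two_zpow_rpow]
      gcongr
    calc ‖f x - u k x - (f y - u k y)‖ₑ ≤ ‖f x - u k x‖ₑ + ‖f y - u k y‖ₑ := enorm_sub_le
      _ ≤ K * 2 ^ (-((k : ℝ) * s)) * G x + K * 2 ^ (-((k : ℝ) * s)) * G y :=
          add_le_add (hf x hx k) (hf y hy k)
      _ = K * 2 ^ (-((k : ℝ) * s)) * (G x + G y) := by ring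
      _ ≤ (2 ^ s * (K + L) + (K + L)) * (P * ENNReal.ofReal (d ^ s')) * (G x + G y) := by
          gcongr
          exact le_self_add.trans le_add_self
      _ = _ := by ring

theorem maximalPow_const_mul {r : ℝ} (hr : 0 < r) {c : ℝ≥0∞} (hc : c ≠ ∞) (G : Rn n → ℝ≥0∞)
    (x : Rn n) : maximalPow r (fun y => c * G y) x = c * maximalPow r G x := by
  have hcr : c ^ r ≠ ∞ := ENNReal.rpow_ne_top_of_nonneg hr.le hc
  have : dyadicMaximal (fun y => (c * G y) ^ r) x = c ^ r * dyadicMaximal (fun y => G y ^ r) x := by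
    rw [dyadicMaximal, dyadicMaximal, ENNReal.mul_iSup]
    refine iSup_congr fun j => ?_
    simp_rw [ENNReal.mul_rpow_of_nonneg _ _ hr.le, setLAverage_eq]
    rw [lintegral_const_mul' _ _ hcr, mul_div_assoc]
  rw [maximalPow, this, ENNReal.mul_rpow_of_nonneg _ _ (by positivity), ← ENNReal.rpow_mul,
    mul_one_div_cancel hr.ne', ENNReal.rpow_one, maximalPow]

/-- The approximations converge in a weighted `L¹` space. -/
theorem tendsto_lintegral_enorm_sub_of_approx (hK : K ≠ ∞) (hL : L ≠ ∞) (hG : Measurable G)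
    (hE : volume E = 0) (hGE : ∀ x ∉ E, G x ≠ ∞) {p : ℝ} (hs : 0 < s) (hs1 : s ≤ 1)
    (hp : (n : ℝ) / (n + s) < p) (hGp : ∫⁻ x, G x ^ p ≠ ∞)
    (hfm : AEStronglyMeasurable f volume) (hum : ∀ k, AEStronglyMeasurable (u k) volume)
    (hf : ∀ x ∉ E, ∀ k : ℤ, ‖f x - u k x‖ₑ ≤ K * 2 ^ (-((k : ℝ) * s)) * G x)
    (hu : ∀ (k : ℤ) (x y : Rn n), dist x y ≤ 2 ^ (-k) → ‖u k x - u k y‖ₑ ≤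
      L * ENNReal.ofReal (2 ^ k * dist x y) * 2 ^ (-((k : ℝ) * s)) * G x) :
    Filter.Tendsto (fun k : ℕ => ∫⁻ y, ‖f y - u k y‖ₑ *
      ENNReal.ofReal ((1 + ‖y‖) ^ (-((n + 2 : ℕ) : ℝ)))) Filter.atTop (nhds 0) := by
  obtain ⟨s', hs', hss', hp'⟩ := exists_smaller_smoothness hs hp
  obtain ⟨r, hr, hr1, hrp, hrs⟩ := exists_order hs' hp'
  have hgrad := isGradientOff_of_approx hK hL hG hE hGE hs hf hu
  set D : ℝ≥0∞ := 2 ^ s * (K + L) + (K + L) with hD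
  have hDt : D ≠ ∞ := by
    have := two_rpow_ne_top s
    finiteness
  set N : ℕ := n + 2
  -- The zero function has `G` as a gradient; this only serves to find a point where `G` and its
  -- maximal function are both finite.
  have hG1 : IsGradientOff s' (fun _ : Rn n => (0 : ℂ)) G E :=
    ⟨hG, hE, hGE, fun x _ y _ => by simp⟩
  obtain ⟨x, hx, hxM⟩ := hG1.exists_notMem_maximalPow_lt_top hr hrp hGp
  have hq : (n : ℝ) + s' < (N : ℝ) := by push_cast [N]; linarith
  obtain ⟨C, hC⟩ := exists_lintegral_enorm_sub_mul_one_add_norm_rpow_le (n := n) hs'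
    (hss'.le.trans hs1) hr hr1 hrs hq
  set W : ℝ≥0∞ := ∫⁻ y : Rn n, ENNReal.ofReal ((1 + ‖y‖) ^ (-(N : ℝ))) with hW
  have hWt : W ≠ ∞ := by
    have h1 : Integrable fun y : Rn n => (1 + ‖y‖) ^ (-(N : ℝ)) :=
      integrable_one_add_norm (by simp [N])
    exact (h1.lintegral_lt_top).ne
  -- The first term is the oscillation of `f - u k` about its value at `x`, through its gradient of
  -- order `s'`; the second is that value times the total mass of the weight.
  have hbound : ∀ k : ℕ, ∫⁻ y, ‖f y - u k y‖ₑ * ENNReal.ofReal ((1 + ‖y‖) ^ (-(N : ℝ))) ≤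
      (ENNReal.ofReal ((1 + ‖x‖) ^ (N : ℝ)) * (C * (D * (maximalPow r G x + G x)))) *
        2 ^ (-(k * (s - s'))) + K * G x * W * 2 ^ (-(k * s)) := fun k => by
    have hv := isGradientOff_sub_of_approx hK hL hG hE hGE hs' hss' hs1 hf hu k
    have h1 := hC _ _ E hv (hfm.sub (hum k)).aemeasurable x hx
    rw [maximalPow_const_mul hr (ENNReal.mul_ne_top hDt (two_rpow_ne_top _))] at h1
    have h2 := hf x hx k
    rw [Int.cast_natCast] at h1 h2
    have hwm : Measurable fun y : Rn n => ENNReal.ofReal ((1 + ‖y‖) ^ (-(N : ℝ))) := by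
      fun_prop
    calc ∫⁻ y, ‖f y - u k y‖ₑ * ENNReal.ofReal ((1 + ‖y‖) ^ (-(N : ℝ)))
        ≤ ∫⁻ y, (‖f y - u k y - (f x - u k x)‖ₑ * ENNReal.ofReal ((1 + ‖y‖) ^ (-(N : ℝ))) +
            ‖f x - u k x‖ₑ * ENNReal.ofReal ((1 + ‖y‖) ^ (-(N : ℝ)))) := by
          refine lintegral_mono fun y => ?_
          rw [← add_mul]
          gcongr
          have := enorm_add_le (f y - u k y - (f x - u k x)) (f x - u k x)
          rwa [sub_add_cancel] at this
      _ = (∫⁻ y, ‖f y - u k y - (f x - u k x)‖ₑ * ENNReal.ofReal ((1 + ‖y‖) ^ (-(N : ℝ)))) +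
            ‖f x - u k x‖ₑ * W := by
          rw [lintegral_add_right _ (hwm.const_mul _), lintegral_const_mul _ hwm]
      _ ≤ ENNReal.ofReal ((1 + ‖x‖) ^ (N : ℝ)) * (C * (D * 2 ^ (-(k * (s - s'))) *
            maximalPow r G x + D * 2 ^ (-(k * (s - s'))) * G x)) +
            K * 2 ^ (-(k * s)) * G x * W := by
          gcongr
      _ = _ := by ring
  refine tendsto_of_tendsto_of_tendsto_of_le_of_le tendsto_const_nhds ?_ (fun _ => zero_le)
    hbound
  have hGx := hGE x hx
  have hMx := hxM.ne
  have h1 := ENNReal.Tendsto.const_mul (a := ENNReal.ofReal ((1 + ‖x‖) ^ (N : ℝ)) *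
    (C * (D * (maximalPow r G x + G x)))) (tendsto_two_rpow_neg (sub_pos.2 hss'))
    (Or.inr (by finiteness))
  have h2 := ENNReal.Tendsto.const_mul (a := K * G x * W) (tendsto_two_rpow_neg hs)
    (Or.inr (by finiteness))
  simpa using h1.add h2

theorem tendsto_integral_mul_of_tendsto_lintegral {ι : Type*} {l : Filter ι} {v : ι → Rn n → ℂ}
    (N : ℕ) (ψ : 𝓢(Rn n, ℂ)) (hfψ : Integrable fun x => f x * ψ x)
    (hvψ : ∀ k, Integrable fun x => ψ x * v k x)
    (h : Filter.Tendsto (fun k => ∫⁻ y, ‖f y - v k y‖ₑ *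
      ENNReal.ofReal ((1 + ‖y‖) ^ (-(N : ℝ)))) l (nhds 0)) :
    Filter.Tendsto (fun k => ∫ x, ψ x * v k x) l (nhds (∫ x, f x * ψ x)) := by
  rw [tendsto_iff_edist_tendsto_0]
  set S : ℝ := 2 ^ N * ((Finset.Iic (N, 0)).sup (schwartzSeminormFamily ℂ (Rn n) ℂ)) ψ with hS
  have hS0 : 0 ≤ S := by positivity
  have h0 := ENNReal.Tendsto.const_mul (a := ENNReal.ofReal S) h (Or.inr ENNReal.ofReal_ne_top)
  rw [mul_zero] at h0
  refine tendsto_of_tendsto_of_tendsto_of_le_of_le tendsto_const_nhds h0 (fun _ => zero_le)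
    fun k => ?_
  rw [edist_comm, edist_eq_enorm_sub, ← integral_sub hfψ (hvψ k)]
  refine (enorm_integral_le_lintegral_enorm _).trans ?_
  rw [← lintegral_const_mul' _ _ ENNReal.ofReal_ne_top]
  refine lintegral_mono fun y => ?_
  rw [show f y * ψ y - ψ y * v k y = (f y - v k y) * ψ y by ring, enorm_mul, mul_left_comm,
    ← ENNReal.ofReal_mul hS0]
  gcongr
  rw [← ofReal_norm]
  exact ENNReal.ofReal_le_ofReal (norm_le_sup_seminorm_mul_rpow N ψ y)

end Approximation

/-! ### Assembling the two inclusions -/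

section Main

variable {n : ℕ}

theorem IsGradientOff.isHajlaszGradient {s : ℝ} {f : Rn n → ℂ} {G : Rn n → ℝ≥0∞}
    {E : Set (Rn n)} (hG : IsGradientOff s f G E) :
    IsHajlaszGradient s f fun x => (G x).toReal := by
  refine ⟨hG.measurable.ennreal_toReal, fun _ => ENNReal.toReal_nonneg, E, hG.null,
    fun x hx y hy => ?_⟩
  have hx' := hG.ne_top x hx
  have hy' := hG.ne_top y hy
  have h := ENNReal.toReal_mono (by finiteness) (hG.le x hx y hy)
  rwa [toReal_enorm, ENNReal.toReal_mul, ENNReal.toReal_ofReal (by positivity),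
    ENNReal.toReal_add hx' hy'] at h

/-- Fix one point `x` off `E`. On a compact set within distance `R` of `x`, `‖f y‖` is at most `‖f
x‖ + R ^ s * (g y + g x)` almost everywhere. -/
theorem IsHajlaszGradient.memLpLoc {s p : ℝ} (hs : 0 < s) {f : Rn n → ℂ} {g : Rn n → ℝ}
    (hg : IsHajlaszGradient s f g) (hgp : MemLp g (ENNReal.ofReal p) volume)
    (hf : AEStronglyMeasurable f volume) : MemLpLoc p f := by
  refine ⟨hf, fun K hK => ?_⟩
  obtain ⟨-, h0, E, hE, h⟩ := hg
  have hE' := measure_eq_zero_iff_ae_notMem.1 hE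
  obtain ⟨x, hx⟩ := hE'.exists
  obtain ⟨R, hR⟩ := hK.isBounded.subset_closedBall x
  have hconst : ∀ c : ℝ, MemLp (fun _ : Rn n => c) (ENNReal.ofReal p) (volume.restrict K) :=
    fun c => by
      have : IsFiniteMeasure (volume.restrict K) :=
        isFiniteMeasure_restrict.2 hK.measure_lt_top.ne
      exact memLp_const c
  have h1 : MemLp (fun y => ‖f x‖ + R ^ s * (g y + g x)) (ENNReal.ofReal p)
      (volume.restrict K) :=
    (hconst ‖f x‖).add (((hgp.restrict K).add (hconst (g x))).const_mul (R ^ s))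
  refine h1.mono' hf.restrict ?_
  filter_upwards [ae_restrict_of_ae hE', ae_restrict_mem hK.measurableSet] with y hy hyK
  have h2 := norm_add_le (f y - f x) (f x)
  rw [sub_add_cancel] at h2
  have h3 : dist y x ≤ R := hR hyK
  have h4 : dist y x ^ s * (g y + g x) ≤ R ^ s * (g y + g x) := by
    have := h0 x
    have := h0 y
    gcongr
  linarith [h y hy x hx]

/-- A function representing a tempered distribution is unique up to null sets. -/
theorem Represents.ae_eq {f f' : Rn n → ℂ} {T : 𝓢'(Rn n, ℂ)} (hf : Represents f T)
    (hf' : Represents f' T) : f' =ᵐ[volume] f := by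
  refine ae_eq_of_integral_contDiff_smul_eq hf'.1 hf.1 fun g hg hc => ?_
  obtain ⟨ψ, hψ⟩ := exists_schwartz_eq_ofReal hg hc
  have h1 := (hf'.2 ψ).2.symm.trans (hf.2 ψ).2
  simpa only [hψ, Complex.real_smul, mul_comm] using h1

theorem IsHajlaszGradient.congr_ae {s : ℝ} {f f' : Rn n → ℂ} {g : Rn n → ℝ}
    (hg : IsHajlaszGradient s f g) (h : f' =ᵐ[volume] f) : IsHajlaszGradient s f' g := by
  obtain ⟨hm, h0, E, hE, hle⟩ := hg
  refine ⟨hm, h0, E ∪ {x | f' x ≠ f x}, measure_union_null hE h, fun x hx y hy => ?_⟩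
  simp only [mem_union, mem_ofPred_eq, not_or, not_not] at hx hy
  rw [hx.2, hy.2]
  exact hle x hx.1 y hy.1

/-- Every distribution in the grand Triebel–Lizorkin space is represented by a function with a
Hajłasz gradient. -/
theorem exists_represents_of_memGrandTL {s p : ℝ} (ℓ : ℕ) (m : ℝ) (hs : 0 < s) (hs1 : s ≤ 1)
    (hp : (n : ℝ) / (n + s) < p) :
    ∃ C : ℝ≥0, ∀ T : 𝓢'(Rn n, ℂ), MemGrandTL (testClass n 0 ℓ m) s p T →
      ∃ (f : Rn n → ℂ) (g : Rn n → ℝ), MemLpLoc p f ∧ IsHajlaszGradient s f g ∧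
        MemLp g (ENNReal.ofReal p) volume ∧ Represents f T ∧
        eLpNorm g (ENNReal.ofReal p) volume ≤ C * grandTLNorm (testClass n 0 ℓ m) s p T := by
  obtain ⟨φ, hφ⟩ := exists_schwartz_integral_eq_one n
  obtain ⟨A, hA⟩ := exists_enorm_mollify_succ_sub_le φ ℓ m s
  obtain ⟨L, hL⟩ := exists_enorm_mollify_sub_le φ ℓ m s
  have hp0 : 0 < p := lt_of_le_of_lt (by positivity) hp
  set K : ℝ≥0∞ := (∑' i : ℕ, (2 : ℝ≥0∞) ^ (-(i * s))) * A with hK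
  have hKt : K ≠ ∞ := ENNReal.mul_ne_top (tsum_two_rpow_neg hs) ENNReal.coe_ne_top
  set c : ℝ≥0∞ := 2 ^ s * (K + L) with hc
  have hct : c ≠ ∞ := by
    have := two_rpow_ne_top s
    finiteness
  refine ⟨c.toNNReal, fun T hT => ?_⟩
  set G := grandMaximal (testClass n 0 ℓ m) s T with hG
  have hGm : Measurable G := measurable_grandMaximal _ s T
  have hnorm := grandTLNorm_eq hp0 (testClass n 0 ℓ m) s T
  have hGp : ∫⁻ x, G x ^ p ≠ ∞ := by
    rw [MemGrandTL, hnorm, ENNReal.rpow_lt_top_iff_of_pos (by positivity)] at hT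
    exact hT.ne
  set E : Set (Rn n) := {x | G x = ∞} with hEdef
  have hE : volume E = 0 := by
    have h1 : ∀ᵐ x, G x ^ p < ∞ := ae_lt_top (hGm.pow_const p) hGp
    refine measure_eq_zero_iff_ae_notMem.2 ?_
    filter_upwards [h1] with x hx
    exact ((ENNReal.rpow_lt_top_iff_of_pos hp0).1 hx).ne
  have hGE : ∀ x ∉ E, G x ≠ ∞ := fun x hx => hx
  -- On the null set where `G` is infinite the value of `f` is irrelevant, so `z` is unconstrained
  -- there and 0 will do.
  have hlim : ∀ x, ∃ z, x ∉ E →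
      Filter.Tendsto (fun k : ℕ => mollify φ T k x) Filter.atTop (nhds z) ∧
      ∀ k : ℤ, ‖z - mollify φ T k x‖ₑ ≤ K * 2 ^ (-((k : ℝ) * s)) * G x := fun x => by
    by_cases hx : x ∈ E
    · exact ⟨0, fun h => absurd hx h⟩
    obtain ⟨z, hz, hz'⟩ := exists_limit_of_enorm_succ_sub_le hs (fun k => mollify φ T k x)
      (M := A * G x) (ENNReal.mul_ne_top ENNReal.coe_ne_top (hGE x hx)) fun k =>
        (hA T k x).trans (le_of_eq (by ring))
    refine ⟨z, fun _ => ⟨hz, fun k => (hz' k).trans (le_of_eq ?_)⟩⟩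
    rw [hK]
    ring
  choose f hf using hlim
  have hum : ∀ k : ℤ, AEStronglyMeasurable (mollify φ T k) volume := fun k =>
    (continuous_mollify φ T k).aestronglyMeasurable
  have hfm : AEStronglyMeasurable f volume :=
    aestronglyMeasurable_of_tendsto_ae Filter.atTop (fun k : ℕ => hum k)
      ((measure_eq_zero_iff_ae_notMem.1 hE).mono fun x hx => (hf x hx).1)
  have hfu := fun x hx => (hf x hx).2
  have hgrad := isGradientOff_of_approx hKt ENNReal.coe_ne_top hGm hE hGE hs hfu (hL T)
  have hcG : ∫⁻ x, (c * G x) ^ p = c ^ p * ∫⁻ x, G x ^ p := by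
    simp_rw [ENNReal.mul_rpow_of_nonneg _ _ hp0.le]
    rw [lintegral_const_mul' _ _ (by finiteness)]
  have hle : eLpNorm (fun x => (c * G x).toReal) (ENNReal.ofReal p) volume ≤
      c.toNNReal * grandTLNorm (testClass n 0 ℓ m) s p T := by
    rw [eLpNorm_ofReal_eq_of_nonneg hp0 fun _ => ENNReal.toReal_nonneg, hnorm,
      ENNReal.coe_toNNReal hct]
    calc _ ≤ (∫⁻ x, (c * G x) ^ p) ^ (1 / p) := by
          gcongr with x
          exact ENNReal.ofReal_toReal_le
      _ = _ := by
          rw [hcG, ENNReal.mul_rpow_of_nonneg _ _ (by positivity), ← ENNReal.rpow_mul,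
            mul_one_div_cancel hp0.ne', ENNReal.rpow_one]
  have hgH := hgrad.isHajlaszGradient
  have hgp : MemLp (fun x => (c * G x).toReal) (ENNReal.ofReal p) volume :=
    ⟨hgH.1.aestronglyMeasurable,
      hle.trans_lt (ENNReal.mul_lt_top ENNReal.coe_lt_top hT)⟩
  obtain ⟨T', hT'⟩ := hgrad.exists_represents hs hs1 hp hfm
    (by rw [hcG]; exact ENNReal.mul_ne_top (by finiteness) hGp)
  have hconv := tendsto_lintegral_enorm_sub_of_approx hKt ENNReal.coe_ne_top hGm hE hGE hs hs1 hp
    hGp hfm hum hfu (hL T)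
  -- `T'` is integration against `f`. Both distributions, applied to `ψ`, are the limit of the
  -- integrals of `ψ` against the mollifications of `T`.
  have hTT' : T = T' := by
    ext ψ
    refine tendsto_nhds_unique (tendsto_integral_mul_mollify hφ T ψ) ?_
    rw [(hT'.2 ψ).2]
    exact tendsto_integral_mul_of_tendsto_lintegral _ ψ (hT'.2 ψ).1
      (fun k => integrable_mul_mollify φ T k ψ) hconv
  exact ⟨f, _, hgH.memLpLoc hs hgp hfm, hgH, hgp, hTT' ▸ hT', hle⟩

end Main

end GrandTL

theorem theorem1p1 (n : ℕ) (hn : 1 ≤ n) (s p m : ℝ) (ℓ : ℕ)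
    (hs₀ : 0 < s) (hs₁ : s ≤ 1) (hp : (n : ℝ) / ((n : ℝ) + s) < p) (hm : (n : ℝ) + 1 < m) :
    -- every function of `Ṁ^{s,p}` is a tempered distribution, and it lies in `𝒜Ḟ^s_{p,∞}`
    (∀ f : GrandTL.Rn n → ℂ, GrandTL.MemHajlasz s p f →
      ∃ T : 𝓢'(GrandTL.Rn n, ℂ), GrandTL.Represents f T ∧
        GrandTL.MemGrandTL (GrandTL.testClass n 0 ℓ m) s p T) ∧
    -- every element of `𝒜Ḟ^s_{p,∞}` is given by a function of `Ṁ^{s,p}`, unique up to null sets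
    (∀ T : 𝓢'(GrandTL.Rn n, ℂ), GrandTL.MemGrandTL (GrandTL.testClass n 0 ℓ m) s p T →
      ∃ f : GrandTL.Rn n → ℂ, GrandTL.MemHajlasz s p f ∧ GrandTL.Represents f T ∧
        ∀ f' : GrandTL.Rn n → ℂ, GrandTL.Represents f' T → f' =ᵐ[volume] f) ∧
    -- the norms are equivalent
    ∃ C : ℝ≥0, 0 < C ∧
      ∀ (f : GrandTL.Rn n → ℂ) (T : 𝓢'(GrandTL.Rn n, ℂ)), GrandTL.MemHajlasz s p f →
        GrandTL.Represents f T →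
          GrandTL.grandTLNorm (GrandTL.testClass n 0 ℓ m) s p T ≤ C * GrandTL.hajlaszNorm s p f ∧
          GrandTL.hajlaszNorm s p f ≤ C * GrandTL.grandTLNorm (GrandTL.testClass n 0 ℓ m) s p T := by
  have hp0 : 0 < p := lt_of_le_of_lt (by positivity) hp
  obtain ⟨A, hA0, hA⟩ := GrandTL.exists_grandTLNorm_le (n := n) ℓ hs₀ hs₁ hp hm
  obtain ⟨B, hB⟩ := GrandTL.exists_represents_of_memGrandTL (n := n) ℓ m hs₀ hs₁ hp
  refine ⟨fun f hf => ?_, fun T hT => ?_, A + B, by positivity, fun f T hf hfT => ⟨?_, ?_⟩⟩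
  · obtain ⟨hloc, g, hg, hgp⟩ := hf
    obtain ⟨E, hE⟩ := hg.exists_isGradientOff
    have hfin : ∫⁻ x, ENNReal.ofReal (g x) ^ p ≠ ∞ := by
      have h := hgp.2
      rw [GrandTL.eLpNorm_ofReal_eq_of_nonneg hp0 hg.2.1,
        ENNReal.rpow_lt_top_iff_of_pos (by positivity)] at h
      exact h.ne
    obtain ⟨T, hT⟩ := hE.exists_represents hs₀ hs₁ hp hloc.1 hfin
    exact ⟨T, hT, (hA f T g hg hT).trans_lt (ENNReal.mul_lt_top ENNReal.coe_lt_top hgp.2)⟩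
  · obtain ⟨f, g, hf, hg, hgp, hfT, -⟩ := hB T hT
    exact ⟨f, ⟨hf, g, hg, hgp⟩, hfT, fun f' hf' => hfT.ae_eq hf'⟩
  · rw [GrandTL.hajlaszNorm, ENNReal.mul_iInf_of_ne (by positivity) ENNReal.coe_ne_top]
    refine le_iInf fun g => ?_
    rw [ENNReal.mul_iInf_of_ne (by positivity) ENNReal.coe_ne_top]
    refine le_iInf fun hg => (hA f T g hg hfT).trans ?_
    gcongr
    exact le_self_add
  · by_cases hT : GrandTL.MemGrandTL (GrandTL.testClass n 0 ℓ m) s p T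
    · obtain ⟨f₀, g, -, hg, -, hf₀, hle⟩ := hB T hT
      refine (iInf₂_le g (hg.congr_ae (hf₀.ae_eq hfT))).trans (hle.trans ?_)
      gcongr
      exact le_add_self
    · rw [GrandTL.MemGrandTL, not_lt, top_le_iff] at hT
      rw [hT, ENNReal.mul_top (by positivity)]
      exact le_top
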